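/- All graphs are finite. A \emph{bigraph} $G$ is a graph with a designated bipartition $(V_1(G),V_2(G))$; isomorphisms of bigraphs map $V_i$ to $V_i$ for $i=1,2$. It is \emph{$\epsilon$-coherent}, where $\epsilon>0$, if every vertex in $V_1(G)$ has degree less than $\epsilon|V_2(G)|$, every vertex in $V_2(G)$ has degree less than $\epsilon|V_1(G)|$, and there are no subsets $Z_i\subseteq V_i(G)$ with $|Z_i|\ge\epsilon|V_i(G)|$ for $i=1,2$ and no edges between $Z_1$ and $Z_2$. A \emph{parade} $\mathcal P=(A_1,\dots,A_{K_1};B_1,\dots,B_{K_2})$ in $G$, of \emph{length} $(K_1,K_2)$ and \emph{width} $(W_1,W_2)$, consists of pairwise disjoint nonempty sets (\emph{blocks}) $A_i\subseteq V_1(G)$, all of cardinality $W_1$, and $B_j\subseteq V_2(G)$, all of cardinality $W_2$. A \emph{contraction} of $\mathcal P$ is a parade $(A_1',\dots,A_{K_1}';B_1',\dots,B_{K_2}')$ with $A_i'\subseteq A_i$ and $B_j'\subseteq B_j$ for all $i,j$. An induced sub-bigraph $H$ of $G$ is \emph{$\mathcal P$-rainbow} if each of its vertices is in a block of $\mathcal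 P$ and no two of them are in the same block; its \emph{support} is the pair $(I,J)$ of the sets of indices $i$, respectively $j$, such that $A_i$, respectively $B_j$, meets $V(H)$, and the order of the blocks induces linear orders on $V_1(H)$ and on $V_2(H)$. A $\mathcal P$-rainbow \emph{copy} of a bigraph $T$ is a $\mathcal P$-rainbow induced sub-bigraph isomorphic to $T$; for an \emph{ordered} bigraph (a bigraph $S$ with linear orders on $V_1(S)$ and on $V_2(S)$) the isomorphism must also respect the orders. The \emph{trace} of an ordered bigraph $S$ relative to $\mathcal P$ is the set of supports of all $\mathcal P$-rainbow copies of $S$. Say that $\mathcal P$ is \emph{$\tau$-support-uniform} if for every ordered tree bigraph $S$ with at most $\tau$ vertices, the trace of $S$ relative to $\mathcal P$ either is empty or consists of all pairs $(I,J)$ with $I\subseteq\{1,\dots,K_1\}$, $J\subseteq\{1,\dots,K_2\}$, $|I|=|V_1(S)|$ and $|J|=|V_2(S)|$. It is \emph{$(\kappa,\tau)$-support-invariant} if for every contraction $\mathcal P'$ of $\mathcal P$ with $|A_i'|\ge\kappa|A_i|$ and $|B_j'|\ge\kappa|B_j|$ for all $i,j$, and every ordered tree bigraph $S$ with at most $\tau$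 vertices, the traces of $S$ relative to $\mathcal P$ and to $\mathcal P'$ are equal. It is \emph{$\lambda$-concave} if there are no $Y\subseteq B_1\cup\dots\cup B_{K_2}$ and $h_1<h_2<h_3$ such that at least $\lambda|A_{h_2}|$ vertices of $A_{h_2}$ have a neighbour in $Y$ and, for $h\in\{h_1,h_3\}$, at least $\lambda|A_h|$ vertices of $A_h$ have no neighbour in $Y$; and the same holds with the roles of the $A$'s and the $B$'s exchanged. \textbf{Theorem.} Let $\delta\ge 2$ and $\eta\ge 0$ be integers. Let $T$ be a rooted tree bigraph such that every vertex has degree at most $\delta+1$ and every path from the root to a leaf (a vertex of degree one) has length less than $\eta$. Let $\tau=\delta^{\eta+1}$, $\lambda=2^{-30\delta}\delta^{-1-\eta}$ and $K=(32\delta+4)\tau+2$. Let $G$ be a bigraph with a parade $\mathcal P$ of length $(K_1,K_2)$, where $K_1,K_2\ge K$, and of width $(W_1,W_2)$, such that $\mathcal P$ is $\lambda$-concave, $(2^{-30\delta},\tau)$-support-invariant and $\tau$-support-uniform. If $G$ is $\epsilon$-coherent for some $\epsilon>0$ with $$\epsilon\le 2^{-30\delta-1}\min\left(\frac{W_1}{|V_1(G)|},\frac{W_2}{|V_2(G)|}\right),$$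 then there is a $\mathcal P$-rainbow copy of $T$ (as an unrooted bigraph) in $G$. -/

import Mathlib

/-- A bigraph: a graph with a designated bipartition `(V₁, V₂)` of its vertex set. -/
structure Bigraph (V : Type*) where
  graph : SimpleGraph V
  V₁ : Set V
  V₂ : Set V
  isCompl : IsCompl V₁ V₂
  isBipartiteWith : graph.IsBipartiteWith V₁ V₂

namespace Bigraph

variable {V W : Type*}

/-- The number of neighbours of `v`. -/
noncomputable def degree (G : Bigraph V) (v : V) : ℕ := (G.graph.neighborSet v).ncard

/-- The induced sub-bigraph `G[X]`. -/
def induce (G : Bigraph V) (X : Set V) : Bigraph X where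
  graph := G.graph.induce X
  V₁ := {x | (x : V) ∈ G.V₁}
  V₂ := {x | (x : V) ∈ G.V₂}
  isCompl := ⟨Set.disjoint_left.2 fun _ h₁ h₂ => Set.disjoint_left.1 G.isCompl.disjoint h₁ h₂,
    codisjoint_iff_le_sup.2 fun x _ =>
      (codisjoint_iff_le_sup.1 G.isCompl.codisjoint (Set.mem_univ (x : V)))⟩
  isBipartiteWith := ⟨Set.disjoint_left.2 fun _ h₁ h₂ =>
    Set.disjoint_left.1 G.isCompl.disjoint h₁ h₂, fun _ _ h => G.isBipartiteWith.2 h⟩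

/-- An isomorphism of bigraphs: a graph isomorphism that respects the two sides. -/
structure Iso (G : Bigraph V) (H : Bigraph W) where
  toGraphIso : G.graph ≃g H.graph
  mem_V₁_iff : ∀ v, toGraphIso v ∈ H.V₁ ↔ v ∈ G.V₁
  mem_V₂_iff : ∀ v, toGraphIso v ∈ H.V₂ ↔ v ∈ G.V₂

/-- `X` and `Y` are anticomplete: there is no edge between them. -/
def Anticomplete (G : Bigraph V) (X Y : Set V) : Prop :=
  ∀ x ∈ X, ∀ y ∈ Y, ¬ G.graph.Adj x y

/-- `G` is `ε`-coherent. -/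
def IsCoherent (G : Bigraph V) (ε : ℝ) : Prop :=
  0 < ε ∧
  (∀ v ∈ G.V₁, (G.degree v : ℝ) < ε * (G.V₂.ncard : ℝ)) ∧
  (∀ v ∈ G.V₂, (G.degree v : ℝ) < ε * (G.V₁.ncard : ℝ)) ∧
  ¬ ∃ Z₁ Z₂ : Set V, Z₁ ⊆ G.V₁ ∧ Z₂ ⊆ G.V₂ ∧ G.Anticomplete Z₁ Z₂ ∧
      ε * (G.V₁.ncard : ℝ) ≤ (Z₁.ncard : ℝ) ∧ ε * (G.V₂.ncard : ℝ) ≤ (Z₂.ncard : ℝ)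

/-- `X` `c`-covers `Y`: at least `c|Y|` vertices of `Y` have a neighbour in `X`. -/
def Covers (G : Bigraph V) (c : ℝ) (X Y : Set V) : Prop :=
  c * (Y.ncard : ℝ) ≤ ({y ∈ Y | ∃ x ∈ X, G.graph.Adj x y}.ncard : ℝ)

/-- `X` `c`-misses `Y`: at least `c|Y|` vertices of `Y` have no neighbour in `X`. -/
def Misses (G : Bigraph V) (c : ℝ) (X Y : Set V) : Prop :=
  c * (Y.ncard : ℝ) ≤ ({y ∈ Y | ¬ ∃ x ∈ X, G.graph.Adj x y}.ncard : ℝ)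

end Bigraph

/-- An ordered bigraph: a bigraph with (strict) linear orders imposed on `V₁` and on `V₂`. -/
structure OrderedBigraph (S : Type*) extends Bigraph S where
  lt₁ : V₁ → V₁ → Prop
  lt₂ : V₂ → V₂ → Prop
  isStrictTotalOrder₁ : IsStrictTotalOrder V₁ lt₁
  isStrictTotalOrder₂ : IsStrictTotalOrder V₂ lt₂

/-- A parade `(A₁, …, A_K; B₁, …, B_L)` of length `(K, L)` in `G`. (The blocks `A i` are disjoint
from the blocks `B j` because `V₁` and `V₂` are disjoint.) -/
structure Parade {V : Type*} (G : Bigraph V) (K L : ℕ) where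
  A : Fin K → Set V
  B : Fin L → Set V
  A_nonempty : ∀ i, (A i).Nonempty
  B_nonempty : ∀ j, (B j).Nonempty
  A_subset : ∀ i, A i ⊆ G.V₁
  B_subset : ∀ j, B j ⊆ G.V₂
  A_disjoint : ∀ i i', i ≠ i' → Disjoint (A i) (A i')
  B_disjoint : ∀ j j', j ≠ j' → Disjoint (B j) (B j')
  A_ncard : ∀ i i', (A i).ncard = (A i').ncard
  B_ncard : ∀ j j', (B j).ncard = (B j').ncard

namespace Parade

variable {V : Type*} {G : Bigraph V} {K L : ℕ}

/-- `P` has width `(W₁, W₂)`. -/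
def HasWidth (P : Parade G K L) (W₁ W₂ : ℕ) : Prop :=
  (∀ i, (P.A i).ncard = W₁) ∧ (∀ j, (P.B j).ncard = W₂)

/-- `P'` is a contraction of `P`. -/
def IsContraction (P' P : Parade G K L) : Prop :=
  (∀ i, P'.A i ⊆ P.A i) ∧ (∀ j, P'.B j ⊆ P.B j)

/-- The induced sub-bigraph `G[X]` is `P`-rainbow: each vertex of `X` belongs to some block,
and no two vertices of `X` belong to the same block. -/
def IsRainbow (P : Parade G K L) (X : Set V) : Prop :=
  (∀ v ∈ X, (∃ i, v ∈ P.A i) ∨ (∃ j, v ∈ P.B j)) ∧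
  (∀ i, (X ∩ P.A i).Subsingleton) ∧ (∀ j, (X ∩ P.B j).Subsingleton)

/-- There is a `P`-rainbow copy of the bigraph `T` in `G`. -/
def HasRainbowCopy (P : Parade G K L) {U : Type*} (T : Bigraph U) : Prop :=
  ∃ X : Set V, P.IsRainbow X ∧ Nonempty (T.Iso (G.induce X))

/-- `u` lies in an earlier block than `v` among `A₁, …, A_K`. -/
def Lt₁ (P : Parade G K L) (u v : V) : Prop := ∃ i j, i < j ∧ u ∈ P.A i ∧ v ∈ P.A j

/-- `u` lies in an earlier block than `v` among `B₁, …, B_L`. -/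
def Lt₂ (P : Parade G K L) (u v : V) : Prop := ∃ i j, i < j ∧ u ∈ P.B i ∧ v ∈ P.B j

/-- `G[X]` is a `P`-rainbow copy of the ordered bigraph `S`: it is `P`-rainbow, and `G[X]` with its
`P`-ordering is isomorphic to `S` as an ordered bigraph. -/
def IsRainbowOrderedCopy (P : Parade G K L) {U : Type*} (S : OrderedBigraph U) (X : Set V) :
    Prop :=
  P.IsRainbow X ∧ ∃ e : S.toBigraph.Iso (G.induce X),
    (∀ u v : S.V₁, S.lt₁ u v ↔ P.Lt₁ (e.toGraphIso u : V) (e.toGraphIso v : V)) ∧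
    (∀ u v : S.V₂, S.lt₂ u v ↔ P.Lt₂ (e.toGraphIso u : V) (e.toGraphIso v : V))

/-- The support of `G[X]`: the indices of the blocks `A i`, and of the blocks `B j`, that meet
`X`. -/
def support (P : Parade G K L) (X : Set V) : Set (Fin K) × Set (Fin L) :=
  ({i | (X ∩ P.A i).Nonempty}, {j | (X ∩ P.B j).Nonempty})

/-- The trace of `S` relative to `P`: the set of supports of all `P`-rainbow copies of `S`. -/
def trace (P : Parade G K L) {U : Type*} (S : OrderedBigraph U) :
    Set (Set (Fin K) × Set (Fin L)) :=
  {p | ∃ X, P.IsRainbowOrderedCopy S X ∧ P.support X = p}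

/-- `P` is `τ`-support-uniform. (Ordered tree bigraphs are finite, so, up to isomorphism, they all
have a vertex set in `Type`.) -/
def IsSupportUniform (P : Parade G K L) (τ : ℕ) : Prop :=
  ∀ (U : Type) [Finite U] (S : OrderedBigraph U), S.graph.IsTree → Nat.card U ≤ τ →
    P.trace S = ∅ ∨ P.trace S = {p | p.1.ncard = S.V₁.ncard ∧ p.2.ncard = S.V₂.ncard}

/-- `P` is `(κ, τ)`-support-invariant. -/
def IsSupportInvariant (P : Parade G K L) (κ : ℝ) (τ : ℕ) : Prop :=
  ∀ P' : Parade G K L, P'.IsContraction P →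
    (∀ i, κ * ((P.A i).ncard : ℝ) ≤ ((P'.A i).ncard : ℝ)) →
    (∀ j, κ * ((P.B j).ncard : ℝ) ≤ ((P'.B j).ncard : ℝ)) →
    ∀ (U : Type) [Finite U] (S : OrderedBigraph U), S.graph.IsTree → Nat.card U ≤ τ →
      P.trace S = P'.trace S

/-- `P` is `c`-top-concave. -/
def IsTopConcave (P : Parade G K L) (c : ℝ) : Prop :=
  ∀ Y : Set V, Y ⊆ ⋃ j, P.B j → ¬ ∃ h₁ h₂ h₃ : Fin K, h₁ < h₂ ∧ h₂ < h₃ ∧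
    G.Covers c Y (P.A h₂) ∧ G.Misses c Y (P.A h₁) ∧ G.Misses c Y (P.A h₃)

/-- `P` is `c`-bottom-concave. -/
def IsBottomConcave (P : Parade G K L) (c : ℝ) : Prop :=
  ∀ Y : Set V, Y ⊆ ⋃ i, P.A i → ¬ ∃ h₁ h₂ h₃ : Fin L, h₁ < h₂ ∧ h₂ < h₃ ∧
    G.Covers c Y (P.B h₂) ∧ G.Misses c Y (P.B h₁) ∧ G.Misses c Y (P.B h₃)

/-- `P` is `c`-concave. -/
def IsConcave (P : Parade G K L) (c : ℝ) : Prop := P.IsTopConcave c ∧ P.IsBottomConcave c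

end Parade

/-! Put κ = 2^(-30δ), so that τλ = κ. A tree of maximum degree at most δ + 1 and height below η has
at most τ vertices (`card_le_of_height`). Support-uniformity and support-invariance therefore say
that, once a subtree of T has one rainbow copy, it has copies with the same order pattern on every
support of the right size and inside any subblocks of proportion κ (`hasTransfer_of_parade`). Larger
subtrees are built by joining two smaller ones R and S along an edge ab, with a in R and b in S,
under the stronger induction hypothesis that any prescribed vertex can be placed in the extreme
block of its side (`IsCore.exists_copy_extreme`).

What is needed is a way to create exactly one edge between a copy of T[R] and a copy of T[S]. Say
that a set touches if it covers half of the second or of the last but one block on the other side.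
By concavity, a subset of a block that does not touch covers at most a λ proportion of each middle
block (`IsRegularPair.middle_le`). Call a side thin at size s if a quarter of each of its blocks
contains no touching set of size at most s. Both sides are thin at size 1; let s be the last size
before thinness first fails, say at the block A k (`exists_thin`). Then all large subsets of A k
contain touching sets of size at most s + 1. Deleting a vertex from a smallest one leaves a set of
size at most s that covers little of the middle blocks but, by concavity again, almost all of the
first or last block B β (`IsRegularPair.exists_efficient`).

Many such sets are chosen with little overlap, and double counting reverses the roles of the sides
(`exists_small_cover`). Suppose that almost every vertex of a quarter of B β is the image of b in a
copy of T[S]. Then there is a set Y of at most s of these vertices such that a κ proportion of A k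
consists of vertices adjacent to some v in Y and to no other vertex of the copy belonging to v
(`IsCore.exists_private`). Since Y has at most s elements, the copies belonging to Y use at most s
vertices of each block, so by thinness they see little of the middle blocks. A copy of T[R] is
transferred to what they do not see, with a among the private neighbours, and one of the copies of
T[S] is attached to it (`IsCore.join`). -/

/-! ### Double counting: from many small covering sets to few vertices with many private neighbours.
-/

section Covering

open scoped Classical

variable {V : Type*}

/-- The vertices of `C` with a neighbour in `X`. -/
noncomputable def nbrsIn (G : SimpleGraph V) (X C : Finset V) : Finset V :=
  C.filter fun y => ∃ x ∈ X, G.Adj x y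

theorem mem_nbrsIn {G : SimpleGraph V} {X C : Finset V} {y : V} :
    y ∈ nbrsIn G X C ↔ y ∈ C ∧ ∃ x ∈ X, G.Adj x y := by
  simp [nbrsIn]

/-- The load that a set `X`, together with an assignment `f` of the vertices of `Q` to their
neighbours in `X`, puts on a vertex `a`. -/
noncomputable def coverLoad (G : SimpleGraph V) (Q : Finset V) (s : ℕ)
    (t : Finset V × (V → V)) (a : V) : ℕ :=
  s * ((nbrsIn G t.1 Q).filter fun b => t.2 b = a).card + Q.card * (if a ∈ t.1 then 1 else 0)

/-- The weights make each of the two summands contribute at most s|Q|: the fibres of the assignment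
are disjoint subsets of Q, and the set has at most s elements. -/
theorem sum_coverLoad_le (G : SimpleGraph V) (Q D : Finset V) (s : ℕ)
    (t : Finset V × (V → V)) (ht : t.1.card ≤ s) :
    ∑ a ∈ D, coverLoad G Q s t a ≤ 2 * s * Q.card := by
  unfold coverLoad
  rw [Finset.sum_add_distrib, ← Finset.mul_sum, ← Finset.mul_sum]
  have h1 : ∑ a ∈ D, ((nbrsIn G t.1 Q).filter fun b => t.2 b = a).card ≤ Q.card := by
    rw [← Finset.card_biUnion]
    · apply Finset.card_le_card
      intro b hb
      simp only [Finset.mem_biUnion, Finset.mem_filter] at hb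
      obtain ⟨a, -, hb, -⟩ := hb
      exact (mem_nbrsIn.1 hb).1
    · intro x _ y _ hxy
      apply Finset.disjoint_left.2
      intro b hb hb'
      simp only [Finset.mem_filter] at hb hb'
      exact hxy (hb.2.symm.trans hb'.2)
  have h2 : ∑ a ∈ D, (if a ∈ t.1 then 1 else 0) ≤ s := by
    rw [← Finset.card_filter]
    refine le_trans (Finset.card_le_card ?_) ht
    intro a ha
    exact (Finset.mem_filter.1 ha).2
  calc _ ≤ s * Q.card + Q.card * s := Nat.add_le_add (Nat.mul_le_mul_left _ h1)
        (Nat.mul_le_mul_left _ h2)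
    _ = 2 * s * Q.card := by ring

theorem coverLoad_le (G : SimpleGraph V) (Q : Finset V) (s : ℕ) (hs : 1 ≤ s)
    (t : Finset V × (V → V)) (a : V) : coverLoad G Q s t a ≤ 2 * s * Q.card := by
  unfold coverLoad
  have h1 : ((nbrsIn G t.1 Q).filter fun b => t.2 b = a).card ≤ Q.card := by
    apply Finset.card_le_card
    intro b hb
    exact (mem_nbrsIn.1 (Finset.mem_filter.1 hb).1).1
  have h2 : (if a ∈ t.1 then 1 else 0) ≤ s := by split_ifs <;> omega
  calc _ ≤ s * Q.card + Q.card * s := Nat.add_le_add (Nat.mul_le_mul_left _ h1)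
        (Nat.mul_le_mul_left _ h2)
    _ = 2 * s * Q.card := by ring

/-- `t = (X, f)` is a set `X ⊆ D` of at most `s` vertices with property `good`, together with an
assignment `f` that sends each vertex of `Q` with a neighbour in `X` to such a neighbour. -/
def IsCoverPiece (G : SimpleGraph V) (Q D : Finset V) (s : ℕ) (good : Finset V → Prop)
    (t : Finset V × (V → V)) : Prop :=
  t.1 ⊆ D ∧ t.1.card ≤ s ∧ good t.1 ∧ ∀ b ∈ nbrsIn G t.1 Q, t.2 b ∈ t.1 ∧ G.Adj (t.2 b) b

theorem exists_coverPiece (G : SimpleGraph V) (Q D : Finset V) (s : ℕ) (good : Finset V → Prop)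
    (h : ∃ X ⊆ D, X.card ≤ s ∧ good X) : ∃ t, IsCoverPiece G Q D s good t := by
  obtain ⟨X, hX, hs, hg⟩ := h
  have : ∀ b : V, ∃ a : V, b ∈ nbrsIn G X Q → a ∈ X ∧ G.Adj a b := by
    intro b
    by_cases hb : b ∈ nbrsIn G X Q
    · obtain ⟨x, hx, hxb⟩ := (mem_nbrsIn.1 hb).2
      exact ⟨x, fun _ => ⟨hx, hxb⟩⟩
    · exact ⟨b, fun h => absurd h hb⟩
  choose f hf using this
  exact ⟨(X, f), hX, hs, hg, hf⟩

/-- Greedy choice. After m pieces the total load is at most 2ms|Q|, so at most 2m vertices carry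
load s|Q| or more; while 4m ≤ |D₀|, they can be avoided and half of D₀ remains. A vertex of the next
piece has load below s|Q| before and gains at most 2s|Q|. The slack `+ 4` admits one last piece, so
that m = |D₀|/4 + 1 is reached. -/
theorem exists_coverPieces_aux (G : SimpleGraph V) (Q D₀ : Finset V) (s : ℕ) (hs : 1 ≤ s)
    (hQ : 0 < Q.card) (good : Finset V → Prop)
    (h : ∀ D ⊆ D₀, D₀.card ≤ 2 * D.card → ∃ X ⊆ D, X.card ≤ s ∧ good X) (m : ℕ)
    (hm : 4 * m ≤ D₀.card + 4) :
    ∃ t : Fin m → Finset V × (V → V), (∀ i, IsCoverPiece G Q D₀ s good (t i)) ∧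
      ∀ a, ∑ i, coverLoad G Q s (t i) a ≤ 3 * s * Q.card := by
  induction m with
  | zero => exact ⟨Fin.elim0, fun i => i.elim0, fun a => by simp⟩
  | succ m ih =>
    obtain ⟨t, ht, hload⟩ := ih (by omega)
    set O := D₀.filter fun a => s * Q.card ≤ ∑ i, coverLoad G Q s (t i) a with hO
    have hOcard : O.card ≤ 2 * m := by
      have h1 : O.card * (s * Q.card) ≤ ∑ a ∈ O, ∑ i, coverLoad G Q s (t i) a := by
        rw [← smul_eq_mul]
        exact Finset.card_nsmul_le_sum _ _ _ fun a ha => (Finset.mem_filter.1 ha).2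
      have h2 : ∑ a ∈ O, ∑ i, coverLoad G Q s (t i) a ≤ m * (2 * s * Q.card) := by
        rw [Finset.sum_comm]
        calc _ ≤ ∑ i : Fin m, 2 * s * Q.card :=
              Finset.sum_le_sum fun i _ => sum_coverLoad_le G Q O s (t i) (ht i).2.1
          _ = _ := by simp
      have hpos : 0 < s * Q.card := Nat.mul_pos hs hQ
      refine le_of_mul_le_mul_right (a := s * Q.card) ?_ hpos
      calc _ ≤ _ := h1
        _ ≤ _ := h2
        _ = _ := by ring
    have hD : D₀.card ≤ 2 * (D₀ \ O).card := by
      have : (D₀ \ O).card + O.card = D₀.card :=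
        Finset.card_sdiff_add_card_eq_card (Finset.filter_subset _ _)
      omega
    obtain ⟨t₀, ht₀⟩ := exists_coverPiece G Q (D₀ \ O) s good (h _ Finset.sdiff_subset hD)
    refine ⟨Fin.cons t₀ t, ?_, ?_⟩
    · intro i
      refine Fin.cases ?_ (fun j => ?_) i
      · simpa using ⟨ht₀.1.trans Finset.sdiff_subset, ht₀.2⟩
      · simpa using ht j
    · intro a
      rw [Fin.sum_univ_succ]
      simp only [Fin.cons_zero, Fin.cons_succ]
      by_cases ha : a ∈ t₀.1
      · have ha' := Finset.mem_sdiff.1 (ht₀.1 ha)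
        have h3 : ∑ i, coverLoad G Q s (t i) a < s * Q.card := by
          by_contra hcon
          exact ha'.2 (Finset.mem_filter.2 ⟨ha'.1, not_lt.1 hcon⟩)
        have h4 := coverLoad_le G Q s hs t₀ a
        have : 3 * s * Q.card = 2 * s * Q.card + s * Q.card := by ring
        omega
      · have : coverLoad G Q s t₀ a = 0 := by
          unfold coverLoad
          rw [if_neg ha, Finset.filter_eq_empty_iff.2]
          · simp
          · intro b hb hab
            exact ha (hab ▸ (ht₀.2.2.2 b hb).1)
        rw [this, zero_add]
        exact hload a

/-- Many small sets with property `good` that overlap little and cover `Q` evenly. -/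
theorem exists_coverPieces (G : SimpleGraph V) (Q D₀ : Finset V) (s : ℕ) (hs : 1 ≤ s)
    (hQ : 0 < Q.card) (good : Finset V → Prop)
    (h : ∀ D ⊆ D₀, D₀.card ≤ 2 * D.card → ∃ X ⊆ D, X.card ≤ s ∧ good X) :
    ∃ (m : ℕ) (t : Fin m → Finset V × (V → V)), D₀.card ≤ 4 * m ∧ 0 < m ∧
      (∀ i, IsCoverPiece G Q D₀ s good (t i)) ∧
      (∀ a, ∑ i, ((nbrsIn G (t i).1 Q).filter fun b => (t i).2 b = a).card ≤ 3 * Q.card) ∧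
      (∀ a, (Finset.univ.filter fun i => a ∈ (t i).1).card ≤ 3 * s) := by
  -- The bound 3s|Q| on the load yields both estimates, dividing its first summand by s and its
  -- second by |Q|.
  obtain ⟨t, ht, hload⟩ := exists_coverPieces_aux G Q D₀ s hs hQ good h (D₀.card / 4 + 1)
    (by omega)
  refine ⟨_, t, by omega, by omega, ht, fun a => ?_, fun a => ?_⟩
  · have h1 : s * ∑ i, ((nbrsIn G (t i).1 Q).filter fun b => (t i).2 b = a).card
        ≤ ∑ i, coverLoad G Q s (t i) a := by
      rw [Finset.mul_sum]
      exact Finset.sum_le_sum fun i _ => Nat.le_add_right _ _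
    refine le_of_mul_le_mul_left (a := s) ?_ hs
    calc _ ≤ _ := h1.trans (hload a)
      _ = _ := by ring
  · have h1 : Q.card * (Finset.univ.filter fun i => a ∈ (t i).1).card
        ≤ ∑ i, coverLoad G Q s (t i) a := by
      rw [Finset.card_filter, Finset.mul_sum]
      exact Finset.sum_le_sum fun i _ => Nat.le_add_left _ _
    refine le_of_mul_le_mul_left (a := Q.card) ?_ hQ
    calc _ ≤ _ := h1.trans (hload a)
      _ = _ := by ring

/-- Among the vertices of `C`, at least half lie in few of the neighbourhoods of the `X i`. -/
theorem card_le_two_mul_filter_few (G : SimpleGraph V) {m : ℕ} (hm : 0 < m)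
    (X : Fin m → Finset V) (C : Finset V) (c : ℝ) (hc : 0 < c)
    (h : ∀ i, ((nbrsIn G (X i) C).card : ℝ) ≤ c * C.card) :
    C.card ≤ 2 * (C.filter fun v => ((Finset.univ.filter fun i => ∃ x ∈ X i, G.Adj x v).card : ℝ)
      ≤ 2 * c * m).card := by
  -- Markov's inequality: the average of `N` over C is at most cm, so at most half of C exceeds
  -- twice that.
  set N : V → ℕ := fun v => (Finset.univ.filter fun i => ∃ x ∈ X i, G.Adj x v).card with hN
  set Bad := C.filter fun v => ¬ ((N v : ℝ) ≤ 2 * c * m) with hBad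
  have hsplit : (C.filter fun v => (N v : ℝ) ≤ 2 * c * m).card + Bad.card = C.card :=
    Finset.card_filter_add_card_filter_not _
  have hsum : ∑ v ∈ C, (N v : ℝ) ≤ m * (c * C.card) := by
    have : ∑ v ∈ C, N v = ∑ i, (nbrsIn G (X i) C).card := by
      simp only [hN, Finset.card_filter, nbrsIn]
      rw [Finset.sum_comm]
    calc ∑ v ∈ C, (N v : ℝ) = ((∑ v ∈ C, N v : ℕ) : ℝ) := by push_cast; rfl
      _ = ∑ i, ((nbrsIn G (X i) C).card : ℝ) := by rw [this]; push_cast; rfl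
      _ ≤ ∑ i : Fin m, c * C.card := Finset.sum_le_sum fun i _ => h i
      _ = _ := by simp
  have hbad : (Bad.card : ℝ) * (2 * c * m) ≤ ∑ v ∈ C, (N v : ℝ) := by
    calc (Bad.card : ℝ) * (2 * c * m) = ∑ v ∈ Bad, (2 * c * m) := by simp
      _ ≤ ∑ v ∈ Bad, (N v : ℝ) := Finset.sum_le_sum fun v hv =>
          (not_le.1 (Finset.mem_filter.1 hv).2).le
      _ ≤ _ := Finset.sum_le_sum_of_subset_of_nonneg (Finset.filter_subset _ _)
          fun _ _ _ => Nat.cast_nonneg _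
  have hm' : (0 : ℝ) < m := by exact_mod_cast hm
  have h2 : (2 * Bad.card : ℝ) ≤ C.card := by
    have h3 : (c * m) * (2 * Bad.card : ℝ) ≤ (c * m) * C.card := by nlinarith
    exact le_of_mul_le_mul_left h3 (by positivity)
  have h3 : 2 * Bad.card ≤ C.card := by exact_mod_cast h2
  change C.card ≤ 2 * (C.filter fun v => (N v : ℝ) ≤ 2 * c * m).card
  omega

/-- Greedy choice of few vertices `Y` whose private neighbours are many. -/
theorem exists_small_cover (G : SimpleGraph V) (Q D₀ : Finset V) (s : ℕ) (hs : 1 ≤ s)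
    (hQ : 0 < Q.card) (good : Finset V → Prop) (m : ℕ) (t : Fin m → Finset V × (V → V))
    (ht : ∀ i, IsCoverPiece G Q D₀ s good (t i))
    (hL₁ : ∀ a, ∑ i, ((nbrsIn G (t i).1 Q).filter fun b => (t i).2 b = a).card ≤ 3 * Q.card)
    (hL₂ : ∀ a, (Finset.univ.filter fun i => a ∈ (t i).1).card ≤ 3 * s)
    (Z : Finset V) (hZ : Z ⊆ Q) (F : V → Finset V)
    (hcount : (m * Q.card : ℝ) ≤ 2 * ∑ b ∈ Z, ((Finset.univ.filter fun i =>
      b ∈ nbrsIn G (t i).1 Q ∧ ∀ v ∈ F b, ¬ ∃ x ∈ (t i).1, G.Adj x v).card : ℝ)) :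
    ∃ Y ⊆ Z, Y.card ≤ s ∧
      (m : ℝ) ≤ 12 *
        ((D₀.filter fun a => ∃ b ∈ Y, G.Adj a b ∧ ∀ v ∈ F b, ¬ G.Adj a v).card : ℝ) := by
  set pr : Finset V → Finset V := fun Y =>
    D₀.filter fun a => ∃ b ∈ Y, G.Adj a b ∧ ∀ v ∈ F b, ¬ G.Adj a v with hpr
  set I : V → Finset (Fin m) := fun b => Finset.univ.filter fun i =>
      b ∈ nbrsIn G (t i).1 Q ∧ ∀ v ∈ F b, ¬ ∃ x ∈ (t i).1, G.Adj x v with hI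
  have hs' : (0 : ℝ) < s := by exact_mod_cast hs
  -- There are at least m|Q|/2 pairs (b, i) with i in `I b`, and at most 3|Q||E| ≤ m|Q|/4 of them
  -- have their assigned neighbour in E. Some b is therefore assigned neighbours outside E by at
  -- least m/4 pieces. These are private neighbours of b, and each lies in at most 3s pieces, so at
  -- least m/(12s) of them are distinct.
  have key : ∀ E : Finset V, (12 * E.card : ℝ) ≤ m → 0 < m → ∃ b ∈ Z,
      (m : ℝ) ≤ 12 * s * (((pr {b}) \ E).card : ℝ) := by
    intro E hE hm
    have hsumE : ∑ b ∈ Z, ((I b).filter fun i => (t i).2 b ∈ E).card ≤ E.card * (3 * Q.card) := by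
      have h1 : ∑ b ∈ Z, ((I b).filter fun i => (t i).2 b ∈ E).card ≤
          ∑ b ∈ Q, ∑ a ∈ E, (Finset.univ.filter fun i : Fin m =>
            b ∈ nbrsIn G (t i).1 Q ∧ (t i).2 b = a).card := by
        refine le_trans (Finset.sum_le_sum (fun b _ => ?_)) (Finset.sum_le_sum_of_subset hZ)
        rw [← Finset.card_biUnion]
        · apply Finset.card_le_card
          intro i hi
          simp only [hI, Finset.mem_filter, Finset.mem_univ, true_and, Finset.mem_biUnion] at hi ⊢
          exact ⟨_, hi.2, hi.1.1, rfl⟩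
        · intro x _ y _ hxy
          apply Finset.disjoint_left.2
          intro i hi hi'
          simp only [Finset.mem_filter] at hi hi'
          exact hxy (hi.2.2.symm.trans hi'.2.2)
      refine h1.trans ?_
      rw [Finset.sum_comm, ← smul_eq_mul]
      refine Finset.sum_le_card_nsmul _ _ _ fun a _ => ?_
      refine le_trans (le_of_eq ?_) (hL₁ a)
      simp only [Finset.card_filter]
      rw [Finset.sum_comm]
      refine Finset.sum_congr rfl fun i _ => ?_
      rw [← Finset.card_filter, ← Finset.card_filter]
      congr 1
      ext b
      simp only [Finset.mem_filter]
      exact ⟨fun h => h.2, fun h => ⟨(mem_nbrsIn.1 h.1).1, h⟩⟩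
    have hsumO : (m * Q.card : ℝ) ≤ 4 * ∑ b ∈ Z, (((I b).filter fun i => (t i).2 b ∉ E).card : ℝ) := by
      have h1 : ∑ b ∈ Z, ((I b).card : ℝ) = ∑ b ∈ Z, (((I b).filter fun i => (t i).2 b ∈ E).card : ℝ)
          + ∑ b ∈ Z, (((I b).filter fun i => (t i).2 b ∉ E).card : ℝ) := by
        rw [← Finset.sum_add_distrib]
        refine Finset.sum_congr rfl fun b _ => ?_
        rw [← Finset.card_filter_add_card_filter_not (s := I b) (fun i => (t i).2 b ∈ E)]
        push_cast
        rfl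
      have h2 : ∑ b ∈ Z, (((I b).filter fun i => (t i).2 b ∈ E).card : ℝ)
          ≤ E.card * (3 * Q.card) := by exact_mod_cast hsumE
      have h3 : (12 * E.card : ℝ) * Q.card ≤ m * Q.card :=
        mul_le_mul_of_nonneg_right hE (Nat.cast_nonneg _)
      have h4 := hcount
      linarith
    have hex : ∃ b ∈ Z, (m : ℝ) ≤ 4 * (((I b).filter fun i => (t i).2 b ∉ E).card : ℝ) := by
      by_contra! hcon
      have hQ' : (0 : ℝ) < Q.card := by exact_mod_cast hQ
      have hm' : (0 : ℝ) < m := by exact_mod_cast hm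
      have hZne : Z.Nonempty := by
        rw [Finset.nonempty_iff_ne_empty]
        rintro rfl
        simp only [Finset.sum_empty, mul_zero] at hsumO
        nlinarith
      have h5 : 4 * ∑ b ∈ Z, (((I b).filter fun i => (t i).2 b ∉ E).card : ℝ) < ∑ b ∈ Z, (m : ℝ) := by
        rw [Finset.mul_sum]
        exact Finset.sum_lt_sum_of_nonempty hZne hcon
      have h6 : ∑ b ∈ Z, (m : ℝ) ≤ m * Q.card := by
        rw [Finset.sum_const, nsmul_eq_mul, mul_comm]
        exact mul_le_mul_of_nonneg_left (by exact_mod_cast Finset.card_le_card hZ) hm'.le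
      linarith
    obtain ⟨b, hb, hbm⟩ := hex
    refine ⟨b, hb, ?_⟩
    have h7 : ((I b).filter fun i => (t i).2 b ∉ E).card ≤ (pr {b} \ E).card * (3 * s) := by
      have : ((I b).filter fun i => (t i).2 b ∉ E) ⊆
          (pr {b} \ E).biUnion fun a => Finset.univ.filter fun i => a ∈ (t i).1 := by
        intro i hi
        simp only [hI, Finset.mem_filter, Finset.mem_univ, true_and, Finset.mem_biUnion,
          Finset.mem_sdiff, hpr, Finset.mem_singleton, exists_eq_left] at hi ⊢
        obtain ⟨⟨hib, hiv⟩, hiE⟩ := hi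
        have hp := (ht i).2.2.2 b hib
        exact ⟨_, ⟨⟨(ht i).1 hp.1, hp.2, fun v hv hadj => hiv v hv ⟨_, hp.1, hadj⟩⟩, hiE⟩, hp.1⟩
      refine (Finset.card_le_card this).trans (Finset.card_biUnion_le.trans ?_)
      rw [← smul_eq_mul]
      exact Finset.sum_le_card_nsmul _ _ _ fun a _ => hL₂ a
    have h8 : (((I b).filter fun i => (t i).2 b ∉ E).card : ℝ) ≤ (pr {b} \ E).card * (3 * s) := by
      exact_mod_cast h7
    linarith
  -- Each round gains m/(12s) private neighbours, unless m/12 are present already, in which case Y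
  -- is kept.
  have step : ∀ n ≤ s, ∃ Y ⊆ Z, Y.card ≤ n ∧ (n * m : ℝ) ≤ 12 * s * ((pr Y).card : ℝ) := by
    intro n
    induction n with
    | zero => exact fun _ => ⟨∅, by simp, by simp, by
        simp only [Nat.cast_zero, zero_mul]; positivity⟩
    | succ n ih =>
      intro hn
      obtain ⟨Y, hYZ, hYn, hY⟩ := ih (by omega)
      by_cases hbig : (m : ℝ) ≤ 12 * ((pr Y).card : ℝ)
      · refine ⟨Y, hYZ, by omega, ?_⟩
        calc ((n + 1 : ℕ) * m : ℝ) ≤ s * m :=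
              mul_le_mul_of_nonneg_right (by exact_mod_cast hn) (Nat.cast_nonneg _)
          _ ≤ s * (12 * ((pr Y).card : ℝ)) := mul_le_mul_of_nonneg_left hbig hs'.le
          _ = _ := by ring
      · push Not at hbig
        have hm : 0 < m := by
          have : (0 : ℝ) < m := lt_of_le_of_lt (by positivity) hbig
          exact_mod_cast this
        obtain ⟨b, hb, hbE⟩ := key (pr Y) hbig.le hm
        refine ⟨insert b Y, Finset.insert_subset hb hYZ, (Finset.card_insert_le _ _).trans (by omega),
          ?_⟩
        have hsub : pr Y ∪ (pr {b} \ pr Y) ⊆ pr (insert b Y) := by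
          intro a ha
          simp only [hpr, Finset.mem_union, Finset.mem_filter, Finset.mem_sdiff,
            Finset.mem_singleton, exists_eq_left, Finset.mem_insert, exists_eq_or_imp] at ha ⊢
          tauto
        have hcard : (pr Y).card + (pr {b} \ pr Y).card ≤ (pr (insert b Y)).card := by
          rw [← Finset.card_union_of_disjoint Finset.disjoint_sdiff]
          exact Finset.card_le_card hsub
        have hcard' : ((pr Y).card : ℝ) + (pr {b} \ pr Y).card ≤ (pr (insert b Y)).card := by
          exact_mod_cast hcard
        push_cast
        nlinarith
  obtain ⟨Y, hYZ, hYs, hY⟩ := step s le_rfl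
  refine ⟨Y, hYZ, hYs, ?_⟩
  have : (s : ℝ) * m ≤ s * (12 * ((pr Y).card : ℝ)) := by linarith
  exact le_of_mul_le_mul_left this hs'

end Covering

/-! ### Splitting a subtree at an edge. -/

section TreeSplit

variable {U : Type*}

/-- Any two vertices of `X` are joined by a walk of `T` within `X`. -/
def ConnectedOn (T : SimpleGraph U) (X : Set U) : Prop :=
  ∀ u ∈ X, ∀ v ∈ X, Relation.ReflTransGen (fun x y => T.Adj x y ∧ y ∈ X) u v

theorem ConnectedOn.exists_adj {T : SimpleGraph U} {X : Set U} (h : ConnectedOn T X) {u v : U}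
    (hu : u ∈ X) (hv : v ∈ X) (huv : u ≠ v) : ∃ w ∈ X, T.Adj u w := by
  rcases Relation.ReflTransGen.cases_head (h u hu v hv) with h | ⟨w, hw, -⟩
  · exact absurd h huv
  · exact ⟨w, hw.2, hw.1⟩

/-- Removing an edge `ab` from a subtree leaves two subtrees. -/
theorem exists_split (T : SimpleGraph U) (hT : T.IsAcyclic) (X : Set U) (hX : ConnectedOn T X)
    (a b : U) (ha : a ∈ X) (hb : b ∈ X) (hab : T.Adj a b) :
    ∃ R S : Set U, a ∈ R ∧ b ∈ S ∧ R ∪ S = X ∧ Disjoint R S ∧ ConnectedOn T R ∧ ConnectedOn T S ∧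
      ∀ u ∈ R, ∀ v ∈ S, T.Adj u v → u = a ∧ v = b := by
  -- R and S are the components of a and b under `H`. They are disjoint because every edge of an
  -- acyclic graph is a bridge.
  let H : U → U → Prop := fun x y => T.Adj x y ∧ x ∈ X ∧ y ∈ X ∧ s(x, y) ≠ s(a, b)
  have Hsymm : ∀ x y, H x y → H y x := fun x y h => ⟨h.1.symm, h.2.2.1, h.2.1, by
    rw [Sym2.eq_swap]; exact h.2.2.2⟩
  have Hrev : ∀ x y, Relation.ReflTransGen H x y → Relation.ReflTransGen H y x := by
    intro x y h
    induction h with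
    | refl => exact .refl
    | tail _ h ih => exact Relation.ReflTransGen.head (Hsymm _ _ h) ih
  have Hreach : ∀ x y, Relation.ReflTransGen H x y → (T \ SimpleGraph.fromEdgeSet {s(a, b)}).Reachable x y := by
    intro x y h
    induction h with
    | refl => exact .refl _
    | tail _ h ih =>
      refine ih.trans (SimpleGraph.Adj.reachable ?_)
      rw [SimpleGraph.sdiff_adj, SimpleGraph.fromEdgeSet_adj]
      exact ⟨h.1, fun h' => h.2.2.2 h'.1⟩
  have hbridge : ¬ Relation.ReflTransGen H a b := by
    intro h
    have := (SimpleGraph.isAcyclic_iff_forall_adj_isBridge.1 hT) hab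
    exact (SimpleGraph.isBridge_iff.1 this) (Hreach _ _ h)
  have hcover : ∀ x ∈ X, Relation.ReflTransGen H a x ∨ Relation.ReflTransGen H b x := by
    intro x hx
    have hmem : ∀ y, Relation.ReflTransGen (fun x y => T.Adj x y ∧ y ∈ X) a y →
        y ∈ X ∧ (Relation.ReflTransGen H a y ∨ Relation.ReflTransGen H b y) := by
      intro y h
      induction h with
      | refl => exact ⟨ha, .inl .refl⟩
      | tail _ h ih =>
        rename_i y z _
        refine ⟨h.2, ?_⟩
        by_cases he : s(y, z) = s(a, b)
        · rcases Sym2.eq_iff.1 he with ⟨-, rfl⟩ | ⟨-, rfl⟩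
          · exact .inr .refl
          · exact .inl .refl
        · have hyz : H y z := ⟨h.1, ih.1, h.2, he⟩
          exact ih.2.imp (fun h => h.tail hyz) (fun h => h.tail hyz)
    exact (hmem x (hX a ha x hx)).2
  have hsub : ∀ c ∈ X, ∀ x, Relation.ReflTransGen H c x → x ∈ X := by
    intro c hc x h
    induction h with
    | refl => exact hc
    | tail _ h _ => exact h.2.2.1
  have hconn : ∀ c, ConnectedOn T {x | Relation.ReflTransGen H c x} := by
    intro c u hu v hv
    have huv : Relation.ReflTransGen H u v := (Hrev _ _ hu).trans hv
    induction huv with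
    | refl => exact .refl
    | tail h1 h2 ih => exact (ih (hu.trans h1)).tail ⟨h2.1, hv⟩
  refine ⟨{x | Relation.ReflTransGen H a x}, {x | Relation.ReflTransGen H b x}, .refl, .refl, ?_, ?_,
    hconn a, hconn b, ?_⟩
  · ext x
    exact ⟨fun h => h.elim (hsub a ha x) (hsub b hb x), hcover x⟩
  · exact Set.disjoint_left.2 fun x h1 h2 => hbridge (Relation.ReflTransGen.trans h1 (Hrev _ _ h2))
  · intro u hu v hv huv
    by_cases he : s(u, v) = s(a, b)
    · rcases Sym2.eq_iff.1 he with h | ⟨rfl, rfl⟩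
      · exact h
      · exact absurd hu hbridge
    · exact absurd ((Relation.ReflTransGen.tail hu ⟨huv, hsub a ha u hu, hsub b hb v hv, he⟩).trans
        (Hrev _ _ hv)) hbridge

end TreeSplit

/-! ### Rainbow copies, their transfer, and the core configuration of blocks. -/

section Copies

open scoped Classical

variable {U V ι₁ ι₂ : Type*}

/-- The map `φ` embeds `T[X]` in `G` as a rainbow induced subgraph: `u` is sent to the block
`A (p u)` or `B (q u)`, depending on its side. -/
structure IsCopy (G : SimpleGraph V) (T : SimpleGraph U) (U₁ U₂ : Set U) (A : ι₁ → Finset V)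
    (B : ι₂ → Finset V) (X : Finset U) (φ : U → V) (p : U → ι₁) (q : U → ι₂) : Prop where
  memA : ∀ u ∈ X, u ∈ U₁ → φ u ∈ A (p u)
  memB : ∀ u ∈ X, u ∈ U₂ → φ u ∈ B (q u)
  injp : ∀ u ∈ X, u ∈ U₁ → ∀ v ∈ X, v ∈ U₁ → p u = p v → u = v
  injq : ∀ u ∈ X, u ∈ U₂ → ∀ v ∈ X, v ∈ U₂ → q u = q v → u = v
  adj : ∀ u ∈ X, u ∈ U₁ → ∀ v ∈ X, v ∈ U₂ → (G.Adj (φ u) (φ v) ↔ T.Adj u v)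

theorem IsCopy.mono {G : SimpleGraph V} {T : SimpleGraph U} {U₁ U₂ : Set U} {A A' : ι₁ → Finset V}
    {B B' : ι₂ → Finset V} {X : Finset U} {φ : U → V} {p : U → ι₁} {q : U → ι₂}
    (h : IsCopy G T U₁ U₂ A' B' X φ p q) (hA : ∀ i, A' i ⊆ A i) (hB : ∀ j, B' j ⊆ B j) :
    IsCopy G T U₁ U₂ A B X φ p q :=
  ⟨fun u hu h₁ => hA _ (h.memA u hu h₁), fun u hu h₂ => hB _ (h.memB u hu h₂), h.injp, h.injq,
    h.adj⟩

/-- The copy `(p', q')` uses the blocks `I` and `J`, in the same order as `(p, q)`. -/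
structure SamePattern (U₁ U₂ : Set U) (X : Finset U) (lt₁ : ι₁ → ι₁ → Prop) (lt₂ : ι₂ → ι₂ → Prop)
    (p p' : U → ι₁) (q q' : U → ι₂) (I : Finset ι₁) (J : Finset ι₂) : Prop where
  imagep : (X.filter (· ∈ U₁)).image p' = I
  imageq : (X.filter (· ∈ U₂)).image q' = J
  lt₁_iff : ∀ u ∈ X, u ∈ U₁ → ∀ v ∈ X, v ∈ U₁ → (lt₁ (p u) (p v) ↔ lt₁ (p' u) (p' v))
  lt₂_iff : ∀ u ∈ X, u ∈ U₂ → ∀ v ∈ X, v ∈ U₂ → (lt₂ (q u) (q v) ↔ lt₂ (q' u) (q' v))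

/-- Copies of subtrees of `T` with at most `τ` vertices can be moved into any family of subblocks
of proportion at least `κ`, and to any support. -/
def HasTransfer (G : SimpleGraph V) (T : SimpleGraph U) (U₁ U₂ : Set U) (A : ι₁ → Finset V)
    (B : ι₂ → Finset V) (κ : ℝ) (τ : ℕ) (lt₁ : ι₁ → ι₁ → Prop) (lt₂ : ι₂ → ι₂ → Prop) : Prop :=
  ∀ (X : Finset U) (φ : U → V) (p : U → ι₁) (q : U → ι₂), X.Nonempty → ConnectedOn T (X : Set U) →
    X.card ≤ τ → IsCopy G T U₁ U₂ A B X φ p q →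
    ∀ (A' : ι₁ → Finset V) (B' : ι₂ → Finset V), (∀ i, A' i ⊆ A i) → (∀ j, B' j ⊆ B j) →
    (∀ i, κ * (A i).card ≤ (A' i).card) → (∀ j, κ * (B j).card ≤ (B' j).card) →
    ∀ (I : Finset ι₁) (J : Finset ι₂), I.card = (X.filter (· ∈ U₁)).card →
    J.card = (X.filter (· ∈ U₂)).card →
    ∃ φ' p' q', IsCopy G T U₁ U₂ A' B' X φ' p' q' ∧ SamePattern U₁ U₂ X lt₁ lt₂ p p' q q' I J

/-- A vertex that precedes all others is sent to the block that precedes all others. -/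
theorem eq_of_extreme {ι : Type*} (lt : ι → ι → Prop) (hasymm : ∀ i j, lt i j → ¬ lt j i)
    (X : Finset U) (p p' : U → ι) (k : ι) (I : Finset ι) (hI : ∀ i ∈ I, lt k i) (a : U) (ha : a ∈ X)
    (hext : ∀ v ∈ X, v ≠ a → lt (p a) (p v)) (himg : X.image p' = insert k I)
    (hlt : ∀ u ∈ X, ∀ v ∈ X, (lt (p u) (p v) ↔ lt (p' u) (p' v))) : p' a = k := by
  -- Some w is sent to k. If w ≠ a, the order pattern puts `p' a` before k, which is impossible for
  -- an index in I.
  have hk : k ∈ X.image p' := by rw [himg]; exact Finset.mem_insert_self _ _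
  obtain ⟨w, hw, hwk⟩ := Finset.mem_image.1 hk
  by_cases hwa : w = a
  · rw [← hwa, hwk]
  · have h1 := (hlt a ha w hw).1 (hext w hw hwa)
    rw [hwk] at h1
    have h2 : p' a ∈ insert k I := himg ▸ Finset.mem_image_of_mem _ ha
    rcases Finset.mem_insert.1 h2 with h2 | h2
    · exact h2
    · exact absurd h1 (hasymm _ _ (hI _ h2))

/-- The neighbourhood in `C` of a family of rainbow sets, one for each `v ∈ Y`. -/
theorem card_filter_family_le {ι : Type*} (G : SimpleGraph V) (Y : Finset V) (φ : V → U → V)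
    (q : V → U → ι) (S : Finset U) (J : Finset ι) (M : ι → Finset V) (s : ℕ) (hY : Y.card ≤ s)
    (hmem : ∀ v ∈ Y, ∀ u ∈ S, φ v u ∈ M (q v u) ∧ q v u ∈ J)
    (hinj : ∀ v ∈ Y, ∀ u ∈ S, ∀ w ∈ S, q v u = q v w → u = w) (C : Finset V) (c : ℝ)
    (hN : ∀ j ∈ J, ∀ Z ⊆ M j, Z.card ≤ s → ((nbrsIn G Z C).card : ℝ) ≤ c) :
    ((C.filter fun y => ∃ v ∈ Y, ∃ u ∈ S, G.Adj (φ v u) y).card : ℝ) ≤ J.card * c := by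
  set Z : ι → Finset V := fun j => (M j).filter fun x => ∃ v ∈ Y, ∃ u ∈ S, q v u = j ∧ φ v u = x
    with hZ
  -- By `hinj`, each v in Y contributes at most one vertex to the block j.
  have hZcard : ∀ j, (Z j).card ≤ s := by
    intro j
    refine le_trans (Finset.card_le_card_of_forall_subsingleton
      (fun x v => ∃ u ∈ S, q v u = j ∧ φ v u = x) ?_ ?_) hY
    · intro x hx
      obtain ⟨v, hv, h⟩ := (Finset.mem_filter.1 hx).2
      exact ⟨v, hv, h⟩
    · rintro v hv x ⟨-, u, hu, huj, rfl⟩ y ⟨-, w, hw, hwj, rfl⟩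
      rw [hinj v hv u hu w hw (huj.trans hwj.symm)]
  have hsub : (C.filter fun y => ∃ v ∈ Y, ∃ u ∈ S, G.Adj (φ v u) y) ⊆
      J.biUnion fun j => nbrsIn G (Z j) C := by
    intro y hy
    obtain ⟨hyC, v, hv, u, hu, hadj⟩ := Finset.mem_filter.1 hy
    have := hmem v hv u hu
    exact Finset.mem_biUnion.2 ⟨q v u, this.2, mem_nbrsIn.2 ⟨hyC, φ v u,
      Finset.mem_filter.2 ⟨this.1, v, hv, u, hu, rfl, rfl⟩, hadj⟩⟩
  calc ((C.filter fun y => ∃ v ∈ Y, ∃ u ∈ S, G.Adj (φ v u) y).card : ℝ)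
      ≤ ((∑ j ∈ J, (nbrsIn G (Z j) C).card : ℕ) : ℝ) := by
        exact_mod_cast (Finset.card_le_card hsub).trans Finset.card_biUnion_le
    _ = ∑ j ∈ J, ((nbrsIn G (Z j) C).card : ℝ) := by push_cast; rfl
    _ ≤ ∑ j ∈ J, c := Finset.sum_le_sum fun j hj => hN j hj _ (Finset.filter_subset _ _) (hZcard j)
    _ = J.card * c := by simp

/-- The configuration of blocks in which subtrees can be joined together. -/
structure IsCore (G : SimpleGraph V) (A : ι₁ → Finset V) (B : ι₂ → Finset V) (κ lam : ℝ)
    (τ s W₁ W₂ : ℕ) (lt₁ : ι₁ → ι₁ → Prop) (lt₂ : ι₂ → ι₂ → Prop) (k : ι₁) (β : ι₂)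
    (I₀ : Finset ι₁) (J₀ : Finset ι₂) (Am : ι₁ → Finset V) (Bm : ι₂ → Finset V)
    (D₀ : Finset V) : Prop where
  κ_pos : 0 < κ
  κ_le : κ ≤ 1 / 1000
  lam_pos : 0 < lam
  lam_mul : τ * lam ≤ κ
  one_le_τ : 1 ≤ τ
  one_le_s : 1 ≤ s
  W₁_pos : 0 < W₁
  W₂_pos : 0 < W₂
  cardA : ∀ i, (A i).card = W₁
  cardB : ∀ j, (B j).card = W₂
  asymm₁ : ∀ i j, lt₁ i j → ¬ lt₁ j i
  asymm₂ : ∀ i j, lt₂ i j → ¬ lt₂ j i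
  lt_I₀ : ∀ i ∈ I₀, lt₁ k i
  lt_J₀ : ∀ j ∈ J₀, lt₂ β j
  card_I₀ : τ ≤ I₀.card
  card_J₀ : τ ≤ J₀.card
  Am_subset : ∀ i, Am i ⊆ A i
  Bm_subset : ∀ j, Bm j ⊆ B j
  card_Am : ∀ i, W₁ ≤ 4 * (Am i).card
  card_Bm : ∀ j, W₂ ≤ 4 * (Bm j).card
  -- The next field includes β while this one omits k: in `join` the copies of T[S] meet B β, at the
  -- image of b, but avoid A k.
  nbrs_Am : ∀ i ∈ I₀, ∀ Y ⊆ Am i, Y.card ≤ s → ∀ j ∈ J₀, ((nbrsIn G Y (B j)).card : ℝ) ≤ lam * W₂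
  nbrs_Bm : ∀ j ∈ insert β J₀, ∀ Y ⊆ Bm j, Y.card ≤ s → ∀ i ∈ I₀,
    ((nbrsIn G Y (A i)).card : ℝ) ≤ lam * W₁
  D₀_subset : D₀ ⊆ A k
  card_D₀ : W₁ ≤ 2 * D₀.card
  exists_cover : ∀ D ⊆ D₀, D₀.card ≤ 2 * D.card → ∃ X ⊆ D, X.card ≤ s ∧
    (((1 - lam) * W₂ ≤ (nbrsIn G X (B β)).card) ∧
      ∀ j ∈ J₀, ((nbrsIn G X (B j)).card : ℝ) ≤ lam * W₂)

namespace IsCore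

variable {G : SimpleGraph V} {A : ι₁ → Finset V} {B : ι₂ → Finset V} {κ lam : ℝ}
  {τ s W₁ W₂ : ℕ} {lt₁ : ι₁ → ι₁ → Prop} {lt₂ : ι₂ → ι₂ → Prop} {k : ι₁} {β : ι₂}
  {I₀ : Finset ι₁} {J₀ : Finset ι₂} {Am : ι₁ → Finset V} {Bm : ι₂ → Finset V} {D₀ : Finset V}

theorem k_notMem (h : IsCore G A B κ lam τ s W₁ W₂ lt₁ lt₂ k β I₀ J₀ Am Bm D₀) : k ∉ I₀ :=
  fun hk => h.asymm₁ _ _ (h.lt_I₀ k hk) (h.lt_I₀ k hk)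

theorem β_notMem (h : IsCore G A B κ lam τ s W₁ W₂ lt₁ lt₂ k β I₀ J₀ Am Bm D₀) : β ∉ J₀ :=
  fun hk => h.asymm₂ _ _ (h.lt_J₀ β hk) (h.lt_J₀ β hk)

theorem lam_le (h : IsCore G A B κ lam τ s W₁ W₂ lt₁ lt₂ k β I₀ J₀ Am Bm D₀) : lam ≤ κ := by
  have h1 : (1 : ℝ) ≤ τ := by exact_mod_cast h.one_le_τ
  nlinarith [h.lam_mul, h.lam_pos]

/-- A set `Z` of vertices of `B β`, each with a rainbow set `F b`, that is almost all of `Bm β`,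
yields a small set whose private neighbours are a positive proportion of `A k`. -/
theorem exists_private (h : IsCore G A B κ lam τ s W₁ W₂ lt₁ lt₂ k β I₀ J₀ Am Bm D₀) :
    ∃ Bs : ι₂ → Finset V, (∀ j, Bs j ⊆ Bm j) ∧ Bs β = Bm β ∧
      (∀ j, κ * (B j).card ≤ (Bs j).card) ∧
      ∀ (Z : Finset V) (F : V → Finset V), Z ⊆ Bm β → ((Bm β \ Z).card : ℝ) ≤ κ * W₂ →
        (∀ b ∈ Z, (F b).card ≤ τ ∧ ∀ v ∈ F b, ∃ j ∈ J₀, v ∈ Bs j) →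
        ∃ Y ⊆ Z, Y.card ≤ s ∧
          κ * W₁ ≤ ((D₀.filter fun a => ∃ b ∈ Y, G.Adj a b ∧ ∀ v ∈ F b, ¬ G.Adj a v).card : ℝ) := by
  have hW₁ : (0 : ℝ) < W₁ := by exact_mod_cast h.W₁_pos
  have hW₂ : (0 : ℝ) < W₂ := by exact_mod_cast h.W₂_pos
  have hκ := h.κ_pos
  have hκ' := h.κ_le
  have hlam := h.lam_le
  have hlam0 := h.lam_pos
  have hlτ := h.lam_mul
  have hQ : 0 < (Bm β).card := by have := h.card_Bm β; have := h.W₂_pos; omega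
  have hQr : (W₂ : ℝ) ≤ 4 * (Bm β).card := by exact_mod_cast h.card_Bm β
  obtain ⟨m, t, hm, hm0, ht, hL₁, hL₂⟩ := exists_coverPieces G (Bm β) D₀ s h.one_le_s hQ _
    h.exists_cover
  have hm0r : (0 : ℝ) < m := by exact_mod_cast hm0
  -- A piece covers at most a 4λ proportion of `Bm j` for j in J₀, so half of `Bm j` is seen by at
  -- most 8λm pieces. The subblocks `Bs` depend on the pieces alone, which is what allows Z and F to
  -- be chosen inside them afterwards.
  set few : V → Prop := fun v =>
    ((Finset.univ.filter fun i => ∃ x ∈ (t i).1, G.Adj x v).card : ℝ) ≤ 8 * lam * m with hfew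
  have hbs : ∀ j ∈ J₀, (Bm j).card ≤ 2 * ((Bm j).filter few).card := by
    intro j hj
    have := card_le_two_mul_filter_few G hm0 (fun i => (t i).1) (Bm j) (4 * lam) (by positivity) (by
      intro i
      have h1 : ((nbrsIn G (t i).1 (Bm j)).card : ℝ) ≤ (nbrsIn G (t i).1 (B j)).card := by
        exact_mod_cast Finset.card_le_card (Finset.filter_subset_filter _ (h.Bm_subset j))
      have h2 := (ht i).2.2.1.2 j hj
      have h3 : (W₂ : ℝ) ≤ 4 * (Bm j).card := by exact_mod_cast h.card_Bm j
      nlinarith)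
    have he : 2 * (4 * lam) * (m : ℝ) = 8 * lam * m := by ring
    rw [he] at this
    exact this
  refine ⟨fun j => if j ∈ J₀ then (Bm j).filter few else Bm j, ?_, ?_, ?_, ?_⟩
  · intro j
    dsimp only
    split_ifs
    · exact Finset.filter_subset _ _
    · exact Finset.Subset.refl _
  · simp [h.β_notMem]
  · intro j
    have h1 : W₂ ≤ 8 * (if j ∈ J₀ then (Bm j).filter few else Bm j).card := by
      have := h.card_Bm j
      split_ifs with hj
      · have := hbs j hj
        omega
      · omega
    have h2 : (W₂ : ℝ) ≤ 8 * (if j ∈ J₀ then (Bm j).filter few else Bm j).card := by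
      exact_mod_cast h1
    rw [h.cardB]
    nlinarith
  · intro Z F hZ hZc hF
    obtain ⟨Y, hYZ, hYs, hY⟩ := exists_small_cover G (Bm β) D₀ s h.one_le_s hQ _ m t ht hL₁ hL₂ Z hZ
      F (by
        -- The at most τ vertices of `F b` are each seen by at most 8λm pieces, so they spoil at
        -- most 8τλm ≤ 8κm of the pieces covering b.
        have hone : ∀ b ∈ Z, ((Finset.univ.filter fun i => b ∈ nbrsIn G (t i).1 (Bm β)).card : ℝ)
            - 8 * κ * m ≤ ((Finset.univ.filter fun i =>
            b ∈ nbrsIn G (t i).1 (Bm β) ∧ ∀ v ∈ F b, ¬ ∃ x ∈ (t i).1, G.Adj x v).card : ℝ) := by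
          intro b hb
          obtain ⟨hFc, hFm⟩ := hF b hb
          have hbad : (((F b).biUnion fun v => Finset.univ.filter fun i =>
              ∃ x ∈ (t i).1, G.Adj x v).card : ℝ) ≤ 8 * κ * m := by
            calc _ ≤ ((∑ v ∈ F b, (Finset.univ.filter fun i =>
                  ∃ x ∈ (t i).1, G.Adj x v).card : ℕ) : ℝ) := by
                  exact_mod_cast Finset.card_biUnion_le
              _ = ∑ v ∈ F b, ((Finset.univ.filter fun i =>
                  ∃ x ∈ (t i).1, G.Adj x v).card : ℝ) := by push_cast; rfl
              _ ≤ ∑ v ∈ F b, 8 * lam * m := by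
                  refine Finset.sum_le_sum fun v hv => ?_
                  obtain ⟨j, hj, hvj⟩ := hFm v hv
                  simp only [hj, if_true] at hvj
                  exact (Finset.mem_filter.1 hvj).2
              _ = (F b).card * lam * (8 * m) := by rw [Finset.sum_const, nsmul_eq_mul]; ring
              _ ≤ κ * (8 * m) := by
                  refine mul_le_mul_of_nonneg_right ?_ (by positivity)
                  refine le_trans (mul_le_mul_of_nonneg_right ?_ hlam0.le) hlτ
                  exact_mod_cast hFc
              _ = _ := by ring
          have hsub : (Finset.univ.filter fun i => b ∈ nbrsIn G (t i).1 (Bm β)) ⊆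
              (Finset.univ.filter fun i => b ∈ nbrsIn G (t i).1 (Bm β) ∧
                ∀ v ∈ F b, ¬ ∃ x ∈ (t i).1, G.Adj x v) ∪
              ((F b).biUnion fun v => Finset.univ.filter fun i => ∃ x ∈ (t i).1, G.Adj x v) := by
            intro i hi
            simp only [Finset.mem_filter, Finset.mem_univ, true_and, Finset.mem_union,
              Finset.mem_biUnion] at hi ⊢
            by_cases hc : ∀ v ∈ F b, ¬ ∃ x ∈ (t i).1, G.Adj x v
            · exact .inl ⟨hi, hc⟩
            · right
              push Not at hc
              exact hc
          have hle : ((Finset.univ.filter fun i => b ∈ nbrsIn G (t i).1 (Bm β)).card : ℝ) ≤ _ :=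
            Nat.cast_le.2 ((Finset.card_le_card hsub).trans (Finset.card_union_le _ _))
          rw [Nat.cast_add] at hle
          linarith
        have hswap : ∑ b ∈ Z, ((Finset.univ.filter fun i => b ∈ nbrsIn G (t i).1 (Bm β)).card : ℝ)
            = ∑ i : Fin m, ((Z.filter fun b => b ∈ nbrsIn G (t i).1 (Bm β)).card : ℝ) := by
          simp only [Finset.card_filter]
          push_cast
          exact Finset.sum_comm
        -- The piece misses at most λW₂ vertices of `B β`, and Z omits at most κW₂ vertices of `Bm
        -- β`.
        have hbig : ∀ i, ((Bm β).card : ℝ) - lam * W₂ - κ * W₂ ≤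
            ((Z.filter fun b => b ∈ nbrsIn G (t i).1 (Bm β)).card : ℝ) := by
          intro i
          have h1 := (ht i).2.2.1.1
          have hsub : Bm β ⊆ ((Z.filter fun b => b ∈ nbrsIn G (t i).1 (Bm β)) ∪ (Bm β \ Z)) ∪
              (B β \ nbrsIn G (t i).1 (B β)) := by
            intro b hb
            simp only [Finset.mem_union, Finset.mem_filter, Finset.mem_sdiff, mem_nbrsIn]
            have hbB := h.Bm_subset β hb
            by_cases h1 : b ∈ Z <;> by_cases h2 : ∃ x ∈ (t i).1, G.Adj x b <;> simp [hb, hbB, h1, h2]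
          have h2 : ((Bm β).card : ℝ) ≤ (Z.filter fun b => b ∈ nbrsIn G (t i).1 (Bm β)).card +
              (Bm β \ Z).card + (B β \ nbrsIn G (t i).1 (B β)).card := by
            exact_mod_cast (Finset.card_le_card hsub).trans
              ((Finset.card_union_le _ _).trans (Nat.add_le_add_right (Finset.card_union_le _ _) _))
          have h3 : ((B β \ nbrsIn G (t i).1 (B β)).card : ℝ) + (nbrsIn G (t i).1 (B β)).card
              = W₂ := by
            rw [← h.cardB β]
            exact_mod_cast Finset.card_sdiff_add_card_eq_card (Finset.filter_subset _ _)
          linarith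
        have hZc' : (Z.card : ℝ) ≤ (Bm β).card := by exact_mod_cast Finset.card_le_card hZ
        have hfin : (m : ℝ) * (((Bm β).card : ℝ) - lam * W₂ - κ * W₂) - (Bm β).card * (8 * κ * m) ≤
            ∑ b ∈ Z, ((Finset.univ.filter fun i =>
            b ∈ nbrsIn G (t i).1 (Bm β) ∧ ∀ v ∈ F b, ¬ ∃ x ∈ (t i).1, G.Adj x v).card : ℝ) := by
          refine le_trans ?_ (Finset.sum_le_sum hone)
          rw [Finset.sum_sub_distrib, hswap]
          have h4 : (m : ℝ) * (((Bm β).card : ℝ) - lam * W₂ - κ * W₂) ≤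
              ∑ i : Fin m, ((Z.filter fun b => b ∈ nbrsIn G (t i).1 (Bm β)).card : ℝ) := by
            have := Finset.sum_le_sum fun (i : Fin m) (_ : i ∈ Finset.univ) => hbig i
            rwa [Finset.sum_const, Finset.card_univ, Fintype.card_fin, nsmul_eq_mul] at this
          have h5 : ∑ b ∈ Z, 8 * κ * (m : ℝ) ≤ (Bm β).card * (8 * κ * m) := by
            rw [Finset.sum_const, nsmul_eq_mul]
            exact mul_le_mul_of_nonneg_right hZc' (by positivity)
          linarith
        have h6 : (Bm β).card ≤ 2 * ((((Bm β).card : ℝ) - lam * W₂ - κ * W₂) - (Bm β).card * (8 * κ)) := by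
          nlinarith
        have h7 := mul_le_mul_of_nonneg_left h6 hm0r.le
        linarith)
    refine ⟨Y, hYZ, hYs, ?_⟩
    -- W₁ ≤ 2|D₀| ≤ 8m, and m is at most 12 times the number of private neighbours; the proportion
    -- 1/96 exceeds κ.
    have h1 : (D₀.card : ℝ) ≤ 4 * m := by exact_mod_cast hm
    have h2 : (W₁ : ℝ) ≤ 2 * D₀.card := by exact_mod_cast h.card_D₀
    nlinarith

end IsCore

end Copies

/-! ### Joining two subtrees, and the induction over subtrees. -/

section Copies

open scoped Classical

variable {U V ι₁ ι₂ : Type*}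

namespace IsCore

variable {G : SimpleGraph V} {A : ι₁ → Finset V} {B : ι₂ → Finset V} {κ lam : ℝ}
  {τ s W₁ W₂ : ℕ} {lt₁ : ι₁ → ι₁ → Prop} {lt₂ : ι₂ → ι₂ → Prop} {k : ι₁} {β : ι₂}
  {I₀ : Finset ι₁} {J₀ : Finset ι₂} {Am : ι₁ → Finset V} {Bm : ι₂ → Finset V} {D₀ : Finset V}

/-- Neighbourhoods of the parts of the copies in n ≤ τ blocks remove at most a τc ≤ κ' proportion,
and 1 - κ' ≥ κ'. -/
theorem le_card_sdiff {κ' c : ℝ} {W n τ : ℕ} (C N : Finset V) (hC : C.card = W) (hN : N ⊆ C)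
    (hNc : (N.card : ℝ) ≤ n * (c * W)) (hn : n ≤ τ) (hc : 0 ≤ c) (h : τ * c ≤ κ')
    (hκ : κ' ≤ 1 / 1000) : κ' * C.card ≤ (C \ N).card := by
  have h1 : ((C \ N).card : ℝ) + N.card = C.card := by
    exact_mod_cast Finset.card_sdiff_add_card_eq_card hN
  have h2 : (n : ℝ) ≤ τ := by exact_mod_cast hn
  have h3 : (n : ℝ) * (c * W) ≤ κ' * W := by
    rw [← mul_assoc]
    exact mul_le_mul_of_nonneg_right ((mul_le_mul_of_nonneg_right h2 hc).trans h) (Nat.cast_nonneg _)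
  have h4 : (0 : ℝ) ≤ W := Nat.cast_nonneg _
  rw [hC] at h1 ⊢
  nlinarith

/-- Two disjoint subtrees joined by one edge `ab`: copies in which `a` and `b` come first can be
joined to a copy of the union. -/
theorem join (h : IsCore G A B κ lam τ s W₁ W₂ lt₁ lt₂ k β I₀ J₀ Am Bm D₀) (T : SimpleGraph U)
    (U₁ U₂ : Set U) (hU : Disjoint U₁ U₂) (htr : HasTransfer G T U₁ U₂ A B κ τ lt₁ lt₂)
    (R S : Finset U) (hRS : Disjoint R S) (hR : ConnectedOn T (R : Set U))
    (hS : ConnectedOn T (S : Set U)) (hcard : (R ∪ S).card ≤ τ) (a b : U) (ha : a ∈ R) (hb : b ∈ S)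
    (ha₁ : a ∈ U₁) (hb₂ : b ∈ U₂) (hab : T.Adj a b)
    (hedge : ∀ u ∈ R, ∀ v ∈ S, T.Adj u v → u = a ∧ v = b)
    (hcR : ∃ φ p q, IsCopy G T U₁ U₂ A B R φ p q ∧ ∀ v ∈ R, v ∈ U₁ → v ≠ a → lt₁ (p a) (p v))
    (hcS : ∃ φ p q, IsCopy G T U₁ U₂ A B S φ p q ∧ ∀ v ∈ S, v ∈ U₂ → v ≠ b → lt₂ (q b) (q v)) :
    ∃ φ p q, IsCopy G T U₁ U₂ A B (R ∪ S) φ p q ∧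
      (∀ v ∈ R ∪ S, v ∈ U₁ → v ≠ a → lt₁ (p a) (p v)) ∧
      (∀ v ∈ R ∪ S, v ∈ U₂ → v ≠ b → lt₂ (q b) (q v)) := by
  obtain ⟨Bs, hBs, hBsβ, hBsc, hpriv⟩ := h.exists_private
  have hW₁ : (0 : ℝ) < W₁ := by exact_mod_cast h.W₁_pos
  have hW₂ : (0 : ℝ) < W₂ := by exact_mod_cast h.W₂_pos
  have hκ := h.κ_pos
  have hκ' := h.κ_le
  have hdisj : ∀ u, u ∈ U₁ → u ∉ U₂ := fun u h₁ h₂ => Set.disjoint_left.1 hU h₁ h₂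
  set R₁ := R.filter (· ∈ U₁) with hR₁
  set R₂ := R.filter (· ∈ U₂) with hR₂
  set S₁ := S.filter (· ∈ U₁) with hS₁
  set S₂ := S.filter (· ∈ U₂) with hS₂
  have haR₁ : a ∈ R₁ := Finset.mem_filter.2 ⟨ha, ha₁⟩
  have hbS₂ : b ∈ S₂ := Finset.mem_filter.2 ⟨hb, hb₂⟩
  have hcard' : R.card + S.card ≤ τ := by rwa [Finset.card_union_of_disjoint hRS] at hcard
  have hR₁c : R₁.card ≤ R.card := Finset.card_filter_le _ _
  have hR₂c : R₂.card ≤ R.card := Finset.card_filter_le _ _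
  have hS₁c : S₁.card ≤ S.card := Finset.card_filter_le _ _
  have hS₂c : S₂.card ≤ S.card := Finset.card_filter_le _ _
  have hR₁p : 0 < R₁.card := Finset.card_pos.2 ⟨a, haR₁⟩
  have hS₂p : 0 < S₂.card := Finset.card_pos.2 ⟨b, hbS₂⟩
  have hI₀ := h.card_I₀
  have hJ₀ := h.card_J₀
  -- disjoint supports for the two subtrees
  obtain ⟨IS, hIS, hISc⟩ := Finset.exists_subset_card_eq (s := I₀) (n := S₁.card) (by omega)
  -- The blocks k and β are reserved for a and b, whence the sizes `R₁.card - 1` and `S₂.card - 1`.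
  obtain ⟨IR, hIR, hIRc⟩ := Finset.exists_subset_card_eq (s := I₀ \ IS) (n := R₁.card - 1) (by
    have := Finset.card_sdiff_add_card_eq_card hIS
    omega)
  obtain ⟨JS, hJS, hJSc⟩ := Finset.exists_subset_card_eq (s := J₀) (n := S₂.card - 1) (by omega)
  obtain ⟨JR, hJR, hJRc⟩ := Finset.exists_subset_card_eq (s := J₀ \ JS) (n := R₂.card) (by
    have := Finset.card_sdiff_add_card_eq_card hJS
    omega)
  have hkI := h.k_notMem
  have hβJ := h.β_notMem
  have hIR₀ : IR ⊆ I₀ := hIR.trans Finset.sdiff_subset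
  have hJR₀ : JR ⊆ J₀ := hJR.trans Finset.sdiff_subset
  have hkIR : k ∉ IR := fun hk => hkI (hIR₀ hk)
  have hβJS : β ∉ JS := fun hk => hβJ (hJS hk)
  have hIRc' : (insert k IR).card = R₁.card := by
    rw [Finset.card_insert_of_notMem hkIR]; omega
  have hJSc' : (insert β JS).card = S₂.card := by
    rw [Finset.card_insert_of_notMem hβJS]; omega
  obtain ⟨φR, pR, qR, hcopyR, hextR⟩ := hcR
  obtain ⟨φS, pS, qS, hcopyS, hextS⟩ := hcS
  have hAmκ : ∀ i, κ * (A i).card ≤ (Am i).card := by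
    intro i
    have : (W₁ : ℝ) ≤ 4 * (Am i).card := by exact_mod_cast h.card_Am i
    rw [h.cardA]
    nlinarith
  -- the copies of `T[S]`, indexed by the image of `b`
  have hZex : ∃ (Z : Finset V) (φ : V → U → V) (p : V → U → ι₁) (q : V → U → ι₂), Z ⊆ Bm β ∧
      ((Bm β \ Z).card : ℝ) ≤ κ * W₂ ∧ ∀ v ∈ Z, IsCopy G T U₁ U₂ Am Bs S (φ v) (p v) (q v) ∧
        S₁.image (p v) = IS ∧ S₂.image (q v) = insert β JS ∧ q v b = β ∧ φ v b = v := by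
    set Z := (Bm β).filter fun v => ∃ (φ : U → V) (p : U → ι₁) (q : U → ι₂),
      IsCopy G T U₁ U₂ Am Bs S φ p q ∧ S₁.image p = IS ∧ S₂.image q = insert β JS ∧ q b = β ∧
        φ b = v with hZ
    have : ∀ v, ∃ (φ : U → V) (p : U → ι₁) (q : U → ι₂), v ∈ Z → IsCopy G T U₁ U₂ Am Bs S φ p q ∧
        S₁.image p = IS ∧ S₂.image q = insert β JS ∧ q b = β ∧ φ b = v := by
      intro v
      by_cases hv : v ∈ Z
      · obtain ⟨φ, p, q, H⟩ := (Finset.mem_filter.1 hv).2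
        exact ⟨φ, p, q, fun _ => H⟩
      · exact ⟨φS, pS, qS, fun hv' => absurd hv' hv⟩
    choose φ p q H using this
    refine ⟨Z, φ, p, q, Finset.filter_subset _ _, ?_, H⟩
    -- Otherwise `Bm β \ Z` is large enough to be a subblock for a transfer. As b is extreme, the
    -- transferred copy of T[S] has b in this subblock, and the image of b then belongs to Z by
    -- definition.
    by_contra! hbig
    obtain ⟨φ', p', q', hc', hpat⟩ := htr S φS pS qS ⟨b, hb⟩ hS (by omega) hcopyS Am
      (Function.update Bs β (Bm β \ Z)) h.Am_subset (by
        intro j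
        by_cases hj : j = β
        · subst hj
          simpa using Finset.sdiff_subset.trans (h.Bm_subset _)
        · rw [Function.update_of_ne hj]
          exact (hBs j).trans (h.Bm_subset j)) hAmκ (by
        intro j
        by_cases hj : j = β
        · subst hj
          rw [Function.update_self, h.cardB]
          exact hbig.le
        · rw [Function.update_of_ne hj]
          exact hBsc j) IS (insert β JS) hISc hJSc'
    have hqb : q' b = β := eq_of_extreme lt₂ h.asymm₂ S₂ qS q' β JS
      (fun j hj => h.lt_J₀ j (hJS hj)) b hbS₂
      (fun v hv hne => hextS v (Finset.mem_filter.1 hv).1 (Finset.mem_filter.1 hv).2 hne) hpat.imageq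
      (fun u hu v hv => hpat.lt₂_iff u (Finset.mem_filter.1 hu).1 (Finset.mem_filter.1 hu).2 v
        (Finset.mem_filter.1 hv).1 (Finset.mem_filter.1 hv).2)
    have hmem := hc'.memB b hb hb₂
    rw [hqb, Function.update_self, Finset.mem_sdiff] at hmem
    refine hmem.2 (Finset.mem_filter.2 ⟨hmem.1, φ', p', q', hc'.mono (fun i => Finset.Subset.refl _) ?_,
      hpat.imagep, hpat.imageq, hqb, rfl⟩)
    intro j
    by_cases hj : j = β
    · subst hj
      rw [Function.update_self, hBsβ]
      exact Finset.sdiff_subset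
    · rw [Function.update_of_ne hj]
  obtain ⟨Z, φ, p, q, hZsub, hZc, hZ⟩ := hZex
  have hqS : ∀ v ∈ Z, ∀ u ∈ S₂, q v u ∈ insert β JS := fun v hv u hu => by
    rw [← (hZ v hv).2.2.1]
    exact Finset.mem_image_of_mem _ hu
  have hpS : ∀ v ∈ Z, ∀ u ∈ S₁, p v u ∈ IS := fun v hv u hu => by
    rw [← (hZ v hv).2.1]
    exact Finset.mem_image_of_mem _ hu
  have hqS' : ∀ v ∈ Z, ∀ u ∈ S₂, u ≠ b → q v u ∈ JS := fun v hv u hu hub => by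
    rcases Finset.mem_insert.1 (hqS v hv u hu) with h1 | h1
    · exact absurd ((hZ v hv).1.injq u (Finset.mem_filter.1 hu).1 (Finset.mem_filter.1 hu).2 b hb hb₂
        (h1.trans (hZ v hv).2.2.2.1.symm)) hub
    · exact h1
  obtain ⟨Y, hYZ, hYs, hgood⟩ := hpriv Z (fun v => (S₂.erase b).image (φ v)) hZsub hZc (by
    intro v hv
    refine ⟨Finset.card_image_le.trans ((Finset.card_erase_le).trans (by omega)), ?_⟩
    intro w hw
    obtain ⟨u, hu, rfl⟩ := Finset.mem_image.1 hw
    have hu' := Finset.mem_erase.1 hu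
    refine ⟨q v u, hJS (hqS' v hv u hu'.2 hu'.1), ?_⟩
    exact (hZ v hv).1.memB u (Finset.mem_filter.1 hu'.2).1 (Finset.mem_filter.1 hu'.2).2)
  set Dg := D₀.filter fun a => ∃ v ∈ Y, G.Adj a v ∧
    ∀ w ∈ (S₂.erase b).image (φ v), ¬ G.Adj a w with hDg
  -- the parts of the blocks that see nothing of the copies of `T[S]` used
  set A' : ι₁ → Finset V := fun i => if i = k then Dg else
    A i \ ((if i ∈ I₀ then A i else ∅).filter fun y => ∃ v ∈ Y, ∃ u ∈ S₂, G.Adj (φ v u) y) with hA'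
  set B' : ι₂ → Finset V := fun j =>
    B j \ ((if j ∈ J₀ then B j else ∅).filter fun y => ∃ v ∈ Y, ∃ u ∈ S₁, G.Adj (φ v u) y) with hB'
  -- All the subblocks keep proportion κ: at k by the choice of Y, and in `I₀` and `J₀` because the
  -- copies indexed by Y use at most s vertices of each block, whose neighbourhoods are bounded by
  -- `nbrs_Am` and `nbrs_Bm`.
  obtain ⟨φ', p', q', hc', hpat⟩ := htr R φR pR qR ⟨a, ha⟩ hR (by omega) hcopyR A' B' (by
      intro i
      simp only [hA']
      split_ifs with hi
      · subst hi
        exact (Finset.filter_subset _ _).trans h.D₀_subset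
      · exact Finset.sdiff_subset
      · exact Finset.sdiff_subset) (fun j => Finset.sdiff_subset) (by
      intro i
      simp only [hA']
      split_ifs with hi hi₀
      · subst hi
        rw [h.cardA]
        exact hgood
      · refine le_card_sdiff _ _ (h.cardA i) (Finset.filter_subset _ _)
          (card_filter_family_le G Y φ q S₂ (insert β JS) Bm s hYs ?_ ?_ (A i) (lam * W₁) ?_)
          (by omega) h.lam_pos.le h.lam_mul hκ'
        · intro v hv u hu
          exact ⟨hBs _ ((hZ v (hYZ hv)).1.memB u (Finset.mem_filter.1 hu).1 (Finset.mem_filter.1 hu).2),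
            hqS v (hYZ hv) u hu⟩
        · intro v hv u hu w hw
          exact (hZ v (hYZ hv)).1.injq u (Finset.mem_filter.1 hu).1 (Finset.mem_filter.1 hu).2 w
            (Finset.mem_filter.1 hw).1 (Finset.mem_filter.1 hw).2
        · intro j hj M hM hMs
          exact h.nbrs_Bm j (Finset.insert_subset_insert _ hJS hj) M hM hMs i hi₀
      · simp only [Finset.filter_empty, Finset.sdiff_empty]
        nlinarith [Nat.cast_nonneg (α := ℝ) (A i).card]) (by
      intro j
      simp only [hB']
      split_ifs with hj₀
      · refine le_card_sdiff _ _ (h.cardB j) (Finset.filter_subset _ _)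
          (card_filter_family_le G Y φ p S₁ IS Am s hYs ?_ ?_ (B j) (lam * W₂) ?_)
          (by omega) h.lam_pos.le h.lam_mul hκ'
        · intro v hv u hu
          exact ⟨(hZ v (hYZ hv)).1.memA u (Finset.mem_filter.1 hu).1 (Finset.mem_filter.1 hu).2,
            hpS v (hYZ hv) u hu⟩
        · intro v hv u hu w hw
          exact (hZ v (hYZ hv)).1.injp u (Finset.mem_filter.1 hu).1 (Finset.mem_filter.1 hu).2 w
            (Finset.mem_filter.1 hw).1 (Finset.mem_filter.1 hw).2
        · intro i hi M hM hMs
          exact h.nbrs_Am i (hIS hi) M hM hMs j hj₀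
      · simp only [Finset.filter_empty, Finset.sdiff_empty]
        nlinarith [Nat.cast_nonneg (α := ℝ) (B j).card]) (insert k IR) JR hIRc' hJRc
  have hpa : p' a = k := eq_of_extreme lt₁ h.asymm₁ R₁ pR p' k IR
      (fun i hi => h.lt_I₀ i (hIR₀ hi)) a haR₁
      (fun v hv hne => hextR v (Finset.mem_filter.1 hv).1 (Finset.mem_filter.1 hv).2 hne) hpat.imagep
      (fun u hu v hv => hpat.lt₁_iff u (Finset.mem_filter.1 hu).1 (Finset.mem_filter.1 hu).2 v
        (Finset.mem_filter.1 hv).1 (Finset.mem_filter.1 hv).2)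
  have hmem := hc'.memA a ha ha₁
  simp only [hA', hpa, if_true] at hmem
  -- Only now is it known which copy of T[S] to keep: the one belonging to the v that the image of a
  -- is adjacent to. This is why `A'` and `B'` had to avoid the neighbours of the copies for all of
  -- Y.
  obtain ⟨haD, v, hvY, hav, hprivate⟩ := Finset.mem_filter.1 hmem
  obtain ⟨hcv, hpv, hqv, hqvb, hvb⟩ := hZ v (hYZ hvY)
  have hp'R : ∀ u ∈ R, u ∈ U₁ → u ≠ a → p' u ∈ IR := by
    intro u hu hu₁ hua
    have : p' u ∈ insert k IR := by
      rw [← hpat.imagep]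
      exact Finset.mem_image_of_mem _ (Finset.mem_filter.2 ⟨hu, hu₁⟩)
    rcases Finset.mem_insert.1 this with h1 | h1
    · exact absurd (hc'.injp u hu hu₁ a ha ha₁ (h1.trans hpa.symm)) hua
    · exact h1
  have hq'R : ∀ u ∈ R, u ∈ U₂ → q' u ∈ JR := by
    intro u hu hu₂
    rw [← hpat.imageq]
    exact Finset.mem_image_of_mem _ (Finset.mem_filter.2 ⟨hu, hu₂⟩)
  have hpvS : ∀ u ∈ S, u ∈ U₁ → p v u ∈ IS := fun u hu hu₁ =>
    hpS v (hYZ hvY) u (Finset.mem_filter.2 ⟨hu, hu₁⟩)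
  have hqvS : ∀ u ∈ S, u ∈ U₂ → u ≠ b → q v u ∈ JS := fun u hu hu₂ hub =>
    hqS' v (hYZ hvY) u (Finset.mem_filter.2 ⟨hu, hu₂⟩) hub
  have hA'sub : ∀ i, A' i ⊆ A i := by
    intro i
    simp only [hA']
    split_ifs with hi
    · subst hi
      exact (Finset.filter_subset _ _).trans h.D₀_subset
    · exact Finset.sdiff_subset
    · exact Finset.sdiff_subset
  have hB'sub : ∀ j, B' j ⊆ B j := fun j => Finset.sdiff_subset
  have hcv' := hcv.mono h.Am_subset (fun j => (hBs j).trans (h.Bm_subset j))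
  have hcR' := hc'.mono hA'sub hB'sub
  have hSR : ∀ u ∈ R, u ∉ S := fun u hu hu' => Finset.disjoint_left.1 hRS hu hu'
  have hpne : ∀ u ∈ R, u ∈ U₁ → ∀ w ∈ S, w ∈ U₁ → p' u ≠ p v w := by
    intro u hu hu₁ w hw hw₁ he
    by_cases hua : u = a
    · rw [hua, hpa] at he
      exact hkI (he ▸ hIS (hpvS w hw hw₁))
    · exact (Finset.mem_sdiff.1 (hIR (hp'R u hu hu₁ hua))).2 (he ▸ hpvS w hw hw₁)
  have hqne : ∀ u ∈ R, u ∈ U₂ → ∀ w ∈ S, w ∈ U₂ → q' u ≠ q v w := by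
    intro u hu hu₂ w hw hw₂ he
    have h1 := Finset.mem_sdiff.1 (hJR (hq'R u hu hu₂))
    by_cases hwb : w = b
    · rw [hwb, hqvb] at he
      exact hβJ (he ▸ h1.1)
    · exact h1.2 (he ▸ hqvS w hw hw₂ hwb)
  refine ⟨fun u => if u ∈ S then φ v u else φ' u, fun u => if u ∈ S then p v u else p' u,
    fun u => if u ∈ S then q v u else q' u, ⟨?_, ?_, ?_, ?_, ?_⟩, ?_, ?_⟩
  · intro u hu hu₁
    rcases Finset.mem_union.1 hu with hu | hu
    · simpa [hSR u hu] using hcR'.memA u hu hu₁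
    · simpa [hu] using hcv'.memA u hu hu₁
  · intro u hu hu₁
    rcases Finset.mem_union.1 hu with hu | hu
    · simpa [hSR u hu] using hcR'.memB u hu hu₁
    · simpa [hu] using hcv'.memB u hu hu₁
  · intro u hu hu₁ w hw hw₁
    rcases Finset.mem_union.1 hu with hu | hu <;> rcases Finset.mem_union.1 hw with hw | hw
    · simpa [hSR u hu, hSR w hw] using hcR'.injp u hu hu₁ w hw hw₁
    · simpa [hSR u hu, hw] using fun he => absurd he (hpne u hu hu₁ w hw hw₁)
    · simpa [hu, hSR w hw] using fun he => absurd he.symm (hpne w hw hw₁ u hu hu₁)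
    · simpa [hu, hw] using hcv'.injp u hu hu₁ w hw hw₁
  · intro u hu hu₁ w hw hw₁
    rcases Finset.mem_union.1 hu with hu | hu <;> rcases Finset.mem_union.1 hw with hw | hw
    · simpa [hSR u hu, hSR w hw] using hcR'.injq u hu hu₁ w hw hw₁
    · simpa [hSR u hu, hw] using fun he => absurd he (hqne u hu hu₁ w hw hw₁)
    · simpa [hu, hSR w hw] using fun he => absurd he.symm (hqne w hw hw₁ u hu hu₁)
    · simpa [hu, hw] using hcv'.injq u hu hu₁ w hw hw₁
  · intro u hu hu₁ w hw hw₂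
    rcases Finset.mem_union.1 hu with hu | hu <;> rcases Finset.mem_union.1 hw with hw | hw
    · simpa [hSR u hu, hSR w hw] using hcR'.adj u hu hu₁ w hw hw₂
    · simp only [hSR u hu, hw, if_true, if_false]
      by_cases hua : u = a
      · by_cases hwb : w = b
        · subst hua hwb
          rw [hvb]
          exact ⟨fun _ => hab, fun _ => hav⟩
        · refine ⟨fun hadj => ?_, fun hadj => absurd (hedge u hu w hw hadj).2 hwb⟩
          exfalso
          refine hprivate (φ v w) (Finset.mem_image_of_mem _ ?_) (hua ▸ hadj)
          exact Finset.mem_erase.2 ⟨hwb, Finset.mem_filter.2 ⟨hw, hw₂⟩⟩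
      · refine ⟨fun hadj => ?_, fun hadj => absurd (hedge u hu w hw hadj).1 hua⟩
        exfalso
        have h1 := hp'R u hu hu₁ hua
        have h2 := hc'.memA u hu hu₁
        have h3 : p' u ≠ k := fun he => hkIR (he ▸ h1)
        simp only [hA', h3, if_false, hIR₀ h1, if_true, Finset.mem_sdiff, Finset.mem_filter] at h2
        exact h2.2 ⟨h2.1, v, hvY, w, Finset.mem_filter.2 ⟨hw, hw₂⟩, hadj.symm⟩
    · simp only [hSR w hw, hu, if_true, if_false]
      refine ⟨fun hadj => ?_, fun hadj => ?_⟩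
      · exfalso
        have h1 := hJR₀ (hq'R w hw hw₂)
        have h2 := hc'.memB w hw hw₂
        simp only [hB', h1, if_true, Finset.mem_sdiff, Finset.mem_filter] at h2
        exact h2.2 ⟨h2.1, v, hvY, u, Finset.mem_filter.2 ⟨hu, hu₁⟩, hadj⟩
      · have := (hedge w hw u hu hadj.symm).1
        exact absurd hw₂ (this ▸ hdisj a ha₁)
    · simpa [hu, hw] using hcv'.adj u hu hu₁ w hw hw₂
  · intro u hu hu₁ hua
    simp only [hSR a ha, if_false, hpa]
    rcases Finset.mem_union.1 hu with hu | hu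
    · simpa [hSR u hu] using h.lt_I₀ _ (hIR₀ (hp'R u hu hu₁ hua))
    · simpa [hu] using h.lt_I₀ _ (hIS (hpvS u hu hu₁))
  · intro u hu hu₂ hub
    simp only [hb, if_true, hqvb]
    rcases Finset.mem_union.1 hu with hu | hu
    · simpa [hSR u hu] using h.lt_J₀ _ (hJR₀ (hq'R u hu hu₂))
    · simpa [hu] using h.lt_J₀ _ (hJS (hqvS u hu hu₂ hub))

/-- Every subtree has a copy, with any prescribed vertex in the first place. -/
theorem exists_copy_extreme (h : IsCore G A B κ lam τ s W₁ W₂ lt₁ lt₂ k β I₀ J₀ Am Bm D₀)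
    (T : SimpleGraph U) (hT : T.IsAcyclic) (U₁ U₂ : Set U) (hU : Disjoint U₁ U₂)
    (hbip : ∀ u v, T.Adj u v → (u ∈ U₁ ∧ v ∈ U₂) ∨ (u ∈ U₂ ∧ v ∈ U₁))
    (htr : HasTransfer G T U₁ U₂ A B κ τ lt₁ lt₂) (n : ℕ) :
    ∀ X : Finset U, X.card = n → X.card ≤ τ → ConnectedOn T (X : Set U) → ∀ u ∈ X,
      ∃ φ p q, IsCopy G T U₁ U₂ A B X φ p q ∧
        (u ∈ U₁ → ∀ v ∈ X, v ∈ U₁ → v ≠ u → lt₁ (p u) (p v)) ∧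
        (u ∈ U₂ → ∀ v ∈ X, v ∈ U₂ → v ≠ u → lt₂ (q u) (q v)) := by
  have hdisj : ∀ u, u ∈ U₁ → u ∉ U₂ := fun u h₁ h₂ => Set.disjoint_left.1 hU h₁ h₂
  induction n using Nat.strong_induction_on with
  | _ n ih =>
    intro X hXn hXτ hX u hu
    by_cases hone : ∃ v ∈ X, u ≠ v
    · obtain ⟨v, hv, huv⟩ := hone
      obtain ⟨w, hw, hadj⟩ := hX.exists_adj hu hv huv
      -- Joining along ab makes both a and b extreme, so an edge at u serves whichever side u is on.
      have main : ∀ a ∈ X, ∀ b ∈ X, a ∈ U₁ → b ∈ U₂ → T.Adj a b →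
          ∃ φ p q, IsCopy G T U₁ U₂ A B X φ p q ∧
            (∀ v ∈ X, v ∈ U₁ → v ≠ a → lt₁ (p a) (p v)) ∧
            (∀ v ∈ X, v ∈ U₂ → v ≠ b → lt₂ (q b) (q v)) := by
        intro a ha b hb ha₁ hb₂ hab
        obtain ⟨R, S, haR, hbS, hRSX, hRS, hR, hS, hedge⟩ := exists_split T hT X hX a b ha hb hab
        have hRX : R ⊆ X := hRSX ▸ Set.subset_union_left
        have hSX : S ⊆ X := hRSX ▸ Set.subset_union_right
        lift R to Finset U using X.finite_toSet.subset hRX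
        lift S to Finset U using X.finite_toSet.subset hSX
        have hX' : R ∪ S = X := by exact_mod_cast hRSX
        have hRS' : Disjoint R S := by exact_mod_cast hRS
        have hc : R.card + S.card = X.card := by
          rw [← hX', Finset.card_union_of_disjoint hRS']
        have hRp : 0 < R.card := Finset.card_pos.2 ⟨a, haR⟩
        have hSp : 0 < S.card := Finset.card_pos.2 ⟨b, hbS⟩
        obtain ⟨φR, pR, qR, hcR, heR, -⟩ := ih R.card (by omega) R rfl (by omega) hR a haR
        obtain ⟨φS, pS, qS, hcS, -, heS⟩ := ih S.card (by omega) S rfl (by omega) hS b hbS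
        have := h.join T U₁ U₂ hU htr R S hRS' hR hS (hX'.symm ▸ hXτ) a b haR hbS ha₁ hb₂ hab hedge
          ⟨φR, pR, qR, hcR, heR ha₁⟩ ⟨φS, pS, qS, hcS, heS hb₂⟩
        rwa [hX'] at this
      rcases hbip u w hadj with ⟨hu₁, hw₂⟩ | ⟨hu₂, hw₁⟩
      · obtain ⟨φ, p, q, hc, he, -⟩ := main u hu w hw hu₁ hw₂ hadj
        exact ⟨φ, p, q, hc, fun _ => he, fun hu₂ => absurd hu₂ (hdisj u hu₁)⟩
      · obtain ⟨φ, p, q, hc, -, he⟩ := main w hw u hu hw₁ hu₂ hadj.symm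
        exact ⟨φ, p, q, hc, fun hu₁ => absurd hu₂ (hdisj u hu₁), fun _ => he⟩
    · push Not at hone
      obtain ⟨x, hx⟩ := Finset.card_pos.1 (by rw [h.cardA k]; exact h.W₁_pos : 0 < (A k).card)
      obtain ⟨y, hy⟩ := Finset.card_pos.1 (by rw [h.cardB β]; exact h.W₂_pos : 0 < (B β).card)
      refine ⟨fun w => if w ∈ U₁ then x else y, fun _ => k, fun _ => β, ⟨?_, ?_, ?_, ?_, ?_⟩, ?_, ?_⟩
      · intro v _ hv₁
        simpa [hv₁] using hx
      · intro v _ hv₂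
        have : v ∉ U₁ := fun hv₁ => hdisj v hv₁ hv₂
        simpa [this] using hy
      · intro v hv _ w hw _ _
        rw [← hone v hv, hone w hw]
      · intro v hv _ w hw _ _
        rw [← hone v hv, hone w hw]
      · intro v hv hv₁ w hw hw₂
        rw [← hone v hv] at hv₁
        rw [← hone w hw] at hw₂
        exact absurd hw₂ (hdisj u hv₁)
      · intro _ v hv _ hvu
        exact absurd (hone v hv).symm hvu
      · intro _ v hv _ hvu
        exact absurd (hone v hv).symm hvu

end IsCore

end Copies

/-! ### Finding a core by concavity: touching sets and thinness. -/

section Selection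

open scoped Classical

variable {U V ι : Type*}

/-- `Y` covers at least half of the second, or of the last but one, of the blocks `B`. -/
def Touches (G : SimpleGraph V) {L : ℕ} (B : Fin L → Finset V) (Y : Finset V) : Prop :=
  ∃ j : Fin L, (j.val = 1 ∨ j.val + 2 = L) ∧ (B j).card ≤ 2 * (nbrsIn G Y (B j)).card

/-- The indices at distance at least two from both ends. -/
def middle (L : ℕ) : Finset (Fin L) := Finset.univ.filter fun j => 2 ≤ j.val ∧ j.val + 3 ≤ L

theorem mem_middle {L : ℕ} {j : Fin L} : j ∈ middle L ↔ 2 ≤ j.val ∧ j.val + 3 ≤ L := by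
  simp [middle]

theorem le_card_middle (L : ℕ) : L ≤ (middle L).card + 4 := by
  have h : (Finset.Ico 2 (L - 2)) ⊆ (middle L).image Fin.val := by
    intro n hn
    rw [Finset.mem_Ico] at hn
    exact Finset.mem_image.2 ⟨⟨n, by omega⟩, mem_middle.2 ⟨hn.1, by simp only; omega⟩, rfl⟩
  have h1 := (Finset.card_le_card h).trans Finset.card_image_le
  rw [Nat.card_Ico] at h1
  omega

/-- The conditions on the adjacency between the blocks `A` and the blocks `B` that are inherited
from concavity and coherence. -/
structure IsRegularPair (G : SimpleGraph V) {L : ℕ} (A : ι → Finset V) (B : Fin L → Finset V)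
    (lam : ℝ) : Prop where
  concave : ∀ i, ∀ Y ⊆ A i, ∀ h₁ h₂ h₃, h₁ < h₂ → h₂ < h₃ →
    lam * (B h₂).card ≤ (nbrsIn G Y (B h₂)).card →
    (nbrsIn G Y (B h₁)).card ≤ (1 - lam) * (B h₁).card →
    ¬ (nbrsIn G Y (B h₃)).card ≤ (1 - lam) * (B h₃).card
  sparse : ∀ i, ∀ x ∈ A i, ∀ j, ((nbrsIn G {x} (B j)).card : ℝ) ≤ 1 / 1000 * (B j).card
  dense : ∀ i, ∀ Z ⊆ A i, (A i).card ≤ 4 * Z.card → ∀ j, (B j).card ≤ 2 * (nbrsIn G Z (B j)).card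

theorem nbrsIn_insert (G : SimpleGraph V) (x : V) (X C : Finset V) :
    nbrsIn G (insert x X) C = nbrsIn G {x} C ∪ nbrsIn G X C := by
  ext y
  simp only [mem_nbrsIn, Finset.mem_union, Finset.mem_insert, Finset.mem_singleton,
    exists_eq_or_imp, exists_eq_left]
  tauto

namespace IsRegularPair

variable {G : SimpleGraph V} {L W : ℕ} {A : ι → Finset V} {B : Fin L → Finset V} {lam : ℝ}

/-- A set that does not touch misses about half of the second and of the last but one block, and the
middle blocks lie between these; concavity does the rest. -/
theorem middle_le (h : IsRegularPair G A B lam) (hB : ∀ j, (B j).card = W)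
    (hlam : lam ≤ 1 / 1000) (i : ι) (Y : Finset V) (hY : Y ⊆ A i)
    (hYt : ¬ Touches G B Y) : ∀ j ∈ middle L, ((nbrsIn G Y (B j)).card : ℝ) ≤ lam * W := by
  intro j hj
  obtain ⟨hj2, hj3⟩ := mem_middle.1 hj
  by_contra! hcon
  have hW : (0 : ℝ) ≤ W := Nat.cast_nonneg _
  have key : ∀ l : Fin L, (l.val = 1 ∨ l.val + 2 = L) →
      ((nbrsIn G Y (B l)).card : ℝ) ≤ (1 - lam) * (B l).card := by
    intro l hl
    have h1 : ¬ (B l).card ≤ 2 * (nbrsIn G Y (B l)).card := fun hc => hYt ⟨l, hl, hc⟩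
    have h2 : 2 * ((nbrsIn G Y (B l)).card : ℝ) ≤ (B l).card := by
      exact_mod_cast (not_le.1 h1).le
    rw [hB] at h2 ⊢
    nlinarith
  refine h.concave i Y hY ⟨1, by omega⟩ j ⟨L - 2, by omega⟩ ?_ ?_ ?_ (key _ (.inl rfl))
    (key _ (.inr ?_))
  · rw [Fin.lt_def]; simp only; omega
  · rw [Fin.lt_def]; simp only; omega
  · rw [hB]; exact hcon.le
  · simp only; omega

/-- If every large subset of the block `A i` contains a small touching set then small subsets
cover almost all of an extreme block. -/
theorem exists_efficient (h : IsRegularPair G A B lam) (hB : ∀ j, (B j).card = W) (hW : 0 < W)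
    (hL : 5 ≤ L) (hlam : lam ≤ 1 / 1000) (i : ι) (s : ℕ)
    (hE : ∀ D ⊆ A i, (A i).card ≤ 4 * D.card → ∃ X ⊆ D, X.card ≤ s + 1 ∧ Touches G B X) :
    ∃ D₀ ⊆ A i, (A i).card ≤ 2 * D₀.card ∧ ∃ β : Fin L, (β.val = 0 ∨ β.val + 1 = L) ∧
      ∀ D ⊆ D₀, D₀.card ≤ 2 * D.card → ∃ X ⊆ D, X.card ≤ s ∧
        (((1 - lam) * W ≤ (nbrsIn G X (B β)).card) ∧
          ∀ j ∈ middle L, ((nbrsIn G X (B j)).card : ℝ) ≤ lam * W) := by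
  set good : Fin L → Finset V → Prop := fun β X => X.card ≤ s ∧
        (((1 - lam) * W ≤ (nbrsIn G X (B β)).card) ∧
          ∀ j ∈ middle L, ((nbrsIn G X (B j)).card : ℝ) ≤ lam * W) with hgood
  have hWr : (0 : ℝ) < W := by exact_mod_cast hW
  set b₀ : Fin L := ⟨0, by omega⟩
  set b₁ : Fin L := ⟨L - 1, by omega⟩
  -- Delete a vertex from a smallest touching set X. The rest does not touch, so it is small on the
  -- middle blocks; by sparsity it still covers nearly half of the block l that X touches. Since l
  -- lies strictly between the first and the last block, concavity forces almost all of one of these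
  -- to be covered. This is why `Touches` avoids the outermost blocks.
  have main : ∀ D ⊆ A i, (A i).card ≤ 4 * D.card → ∃ X ⊆ D, good b₀ X ∨ good b₁ X := by
    intro D hD hDc
    have hex : ∃ n, ∃ X ⊆ D, X.card = n ∧ Touches G B X := by
      obtain ⟨X, hX, -, ht⟩ := hE D hD hDc
      exact ⟨_, X, hX, rfl, ht⟩
    obtain ⟨X, hXD, hXn, l, hl, hlc⟩ := Nat.find_spec hex
    have hmin : ∀ Y ⊆ D, Touches G B Y → X.card ≤ Y.card := by
      intro Y hY hYt
      rw [hXn]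
      exact Nat.find_min' hex ⟨Y, hY, rfl, hYt⟩
    have hXs : X.card ≤ s + 1 := by
      obtain ⟨Y, hY, hYs, hYt⟩ := hE D hD hDc
      exact (hmin Y hY hYt).trans hYs
    have hne : X.Nonempty := by
      rw [Finset.nonempty_iff_ne_empty]
      rintro rfl
      have : nbrsIn G ∅ (B l) = ∅ := by ext y; simp [mem_nbrsIn]
      rw [this, hB] at hlc
      simp at hlc
      omega
    obtain ⟨x, hx⟩ := hne
    have hX'D : X.erase x ⊆ D := (Finset.erase_subset _ _).trans hXD
    have hX't : ¬ Touches G B (X.erase x) := by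
      intro ht
      have := hmin _ hX'D ht
      have := Finset.card_erase_lt_of_mem hx
      omega
    have hmid := h.middle_le hB hlam i (X.erase x) (hX'D.trans hD) hX't
    have hcard : (X.erase x).card ≤ s := by
      rw [Finset.card_erase_of_mem hx]
      omega
    have hl' : lam * (B l).card ≤ (nbrsIn G (X.erase x) (B l)).card := by
      have h1 : ((nbrsIn G X (B l)).card : ℝ) ≤
          (nbrsIn G {x} (B l)).card + (nbrsIn G (X.erase x) (B l)).card := by
        rw [← Finset.insert_erase hx, nbrsIn_insert, Finset.erase_insert (Finset.notMem_erase x X)]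
        exact_mod_cast Finset.card_union_le _ _
      have h2 := h.sparse i x (hD (hXD hx)) l
      have h3 : ((B l).card : ℝ) ≤ 2 * (nbrsIn G X (B l)).card := by exact_mod_cast hlc
      rw [hB] at *
      nlinarith
    refine ⟨X.erase x, hX'D, ?_⟩
    by_contra! hcon
    simp only [hgood, hcard, true_and] at hcon
    have hb₀ : ((nbrsIn G (X.erase x) (B b₀)).card : ℝ) ≤ (1 - lam) * W := by
      by_contra! hc
      exact hcon.1 ⟨hc.le, hmid⟩
    have hb₁ : ((nbrsIn G (X.erase x) (B b₁)).card : ℝ) ≤ (1 - lam) * W := by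
      by_contra! hc
      exact hcon.2 ⟨hc.le, hmid⟩
    refine h.concave i (X.erase x) (hX'D.trans hD) b₀ l b₁ ?_ ?_ hl' ?_ ?_
    · rw [Fin.lt_def]; simp only [b₀]; omega
    · rw [Fin.lt_def]; simp only [b₁]; omega
    · rw [hB]; exact hb₀
    · rw [hB]; exact hb₁
  -- One extreme block must serve all D. If `b₀` fails on some D₀ with at least half of `A i`, then
  -- `b₁` serves every half of D₀. These are quarters of `A i`, whence the factor 4 in `IsThin`.
  by_cases htype : ∀ D ⊆ A i, (A i).card ≤ 2 * D.card → ∃ X ⊆ D, good b₀ X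
  · exact ⟨A i, Finset.Subset.refl _, by omega, b₀, .inl rfl, htype⟩
  · push Not at htype
    obtain ⟨D₀, hD₀, hD₀c, hbad⟩ := htype
    refine ⟨D₀, hD₀, hD₀c, b₁, .inr (by simp only [b₁]; omega), fun D hD hDc => ?_⟩
    obtain ⟨X, hX, hXg⟩ := main D (hD.trans hD₀) (by omega)
    rcases hXg with hXg | hXg
    · exact absurd hXg (hbad X (hX.trans hD))
    · exact ⟨X, hX, hXg⟩

end IsRegularPair

/-- In every block `A i`, a quarter of the vertices contain no touching set of size at most `s`. -/
def IsThin (G : SimpleGraph V) {L : ℕ} (A : ι → Finset V) (B : Fin L → Finset V) (s : ℕ) : Prop :=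
  ∀ i, ∃ C ⊆ A i, (A i).card ≤ 4 * C.card ∧ ∀ Y ⊆ C, Y.card ≤ s → ¬ Touches G B Y

/-- On the first side there are at least 2τ + 2 middle blocks, so τ of them lie on one side of k,
while β is the first or the last block. Each order is taken forwards or backwards so that k and β
come before the chosen blocks. -/
theorem exists_core_of_thin {G : SimpleGraph V} {L₁ L₂ : ℕ} {A : Fin L₁ → Finset V}
    {B : Fin L₂ → Finset V} {κ lam : ℝ} {τ s W₁ W₂ : ℕ} (hA : ∀ i, (A i).card = W₁)
    (hB : ∀ j, (B j).card = W₂) (hW₁ : 0 < W₁) (hW₂ : 0 < W₂) (hκ : 0 < κ) (hκ' : κ ≤ 1 / 1000)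
    (hlam : 0 < lam) (hlamτ : τ * lam ≤ κ) (hτ : 1 ≤ τ) (hs : 1 ≤ s) (hL₁ : 2 * τ + 6 ≤ L₁)
    (hL₂ : 2 * τ + 6 ≤ L₂) (hAB : IsRegularPair G A B lam) (hBA : IsRegularPair G B A lam)
    (htA : IsThin G A B s) (htB : IsThin G B A s) (hnt : ¬ IsThin G A B (s + 1)) :
    ∃ (lt₁ : Fin L₁ → Fin L₁ → Prop) (lt₂ : Fin L₂ → Fin L₂ → Prop) (k : Fin L₁) (β : Fin L₂)
      (I₀ : Finset (Fin L₁)) (J₀ : Finset (Fin L₂)) (Am : Fin L₁ → Finset V)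
      (Bm : Fin L₂ → Finset V) (D₀ : Finset V), ((lt₁ = (· < ·)) ∨ lt₁ = (· > ·)) ∧
      ((lt₂ = (· < ·)) ∨ lt₂ = (· > ·)) ∧
      IsCore G A B κ lam τ s W₁ W₂ lt₁ lt₂ k β I₀ J₀ Am Bm D₀ := by
  have hlamle : lam ≤ 1 / 1000 := by
    have : (1 : ℝ) ≤ τ := by exact_mod_cast hτ
    nlinarith
  unfold IsThin at hnt
  push Not at hnt
  obtain ⟨k, hk⟩ := hnt
  obtain ⟨D₀, hD₀, hD₀c, β, hβ, hcov⟩ := hAB.exists_efficient hB hW₂ (by omega) hlamle k s hk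
  choose Am hAm hAmc hAmt using htA
  choose Bm hBm hBmc hBmt using htB
  have hside₁ : ∃ (lt₁ : Fin L₁ → Fin L₁ → Prop) (I₀ : Finset (Fin L₁)),
      ((lt₁ = (· < ·)) ∨ lt₁ = (· > ·)) ∧ I₀ ⊆ middle L₁ ∧ (∀ i ∈ I₀, lt₁ k i) ∧ τ ≤ I₀.card := by
    have hsub : middle L₁ ⊆ insert k ((middle L₁).filter (k < ·) ∪ (middle L₁).filter (k > ·)) := by
      intro i hi
      simp only [Finset.mem_insert, Finset.mem_union, Finset.mem_filter]
      rcases lt_trichotomy k i with h | h | h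
      · exact .inr (.inl ⟨hi, h⟩)
      · exact .inl h.symm
      · exact .inr (.inr ⟨hi, h⟩)
    have h1 := (Finset.card_le_card hsub).trans
      ((Finset.card_insert_le _ _).trans (Nat.add_le_add_right (Finset.card_union_le _ _) 1))
    have h2 := le_card_middle L₁
    by_cases h3 : τ ≤ ((middle L₁).filter (k < ·)).card
    · exact ⟨_, _, .inl rfl, Finset.filter_subset _ _, fun i hi => (Finset.mem_filter.1 hi).2, h3⟩
    · exact ⟨_, (middle L₁).filter (k > ·), .inr rfl, Finset.filter_subset _ _,
        fun i hi => (Finset.mem_filter.1 hi).2, by omega⟩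
  have hside₂ : ∃ lt₂ : Fin L₂ → Fin L₂ → Prop,
      ((lt₂ = (· < ·)) ∨ lt₂ = (· > ·)) ∧ (∀ j ∈ middle L₂, lt₂ β j) := by
    rcases hβ with hβ | hβ
    · refine ⟨_, .inl rfl, fun j hj => ?_⟩
      have := mem_middle.1 hj
      rw [Fin.lt_def]
      omega
    · refine ⟨_, .inr rfl, fun j hj => ?_⟩
      have := mem_middle.1 hj
      rw [gt_iff_lt, Fin.lt_def]
      omega
  obtain ⟨lt₁, I₀, hlt₁, hI₀, hI₀k, hI₀c⟩ := hside₁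
  obtain ⟨lt₂, hlt₂, hJ₀⟩ := hside₂
  have asymm : ∀ {L : ℕ} (lt : Fin L → Fin L → Prop), ((lt = (· < ·)) ∨ lt = (· > ·)) →
      ∀ i j, lt i j → ¬ lt j i := by
    rintro L lt (rfl | rfl) i j h h'
    · exact lt_asymm h h'
    · exact lt_asymm h h'
  refine ⟨lt₁, lt₂, k, β, I₀, middle L₂, Am, Bm, D₀, hlt₁, hlt₂, ?_⟩
  exact
    { κ_pos := hκ
      κ_le := hκ'
      lam_pos := hlam
      lam_mul := hlamτ
      one_le_τ := hτ
      one_le_s := hs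
      W₁_pos := hW₁
      W₂_pos := hW₂
      cardA := hA
      cardB := hB
      asymm₁ := asymm lt₁ hlt₁
      asymm₂ := asymm lt₂ hlt₂
      lt_I₀ := hI₀k
      lt_J₀ := hJ₀
      card_I₀ := hI₀c
      card_J₀ := by have := le_card_middle L₂; omega
      Am_subset := hAm
      Bm_subset := hBm
      card_Am := fun i => hA i ▸ hAmc i
      card_Bm := fun j => hB j ▸ hBmc j
      nbrs_Am := fun i _ Y hY hYs =>
        hAB.middle_le hB hlamle i Y (hY.trans (hAm i)) (hAmt i Y hY hYs)
      nbrs_Bm := fun j _ Y hY hYs i hi =>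
        hBA.middle_le hA hlamle j Y (hY.trans (hBm j)) (hBmt j Y hY hYs) i (hI₀ hi)
      D₀_subset := hD₀
      card_D₀ := hA k ▸ hD₀c
      exists_cover := hcov }

theorem IsRegularPair.isThin_one {G : SimpleGraph V} {L W : ℕ} {A : ι → Finset V} {B : Fin L → Finset V}
    {lam : ℝ} (h : IsRegularPair G A B lam) (hB : ∀ j, (B j).card = W) (hW : 0 < W) :
    IsThin G A B 1 := by
  intro i
  refine ⟨A i, Finset.Subset.refl _, by omega, fun Y hY hY1 => ?_⟩
  rintro ⟨j, -, hj⟩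
  rw [hB] at hj
  rcases Y.eq_empty_or_nonempty with rfl | ⟨x, hx⟩
  · have : nbrsIn G ∅ (B j) = ∅ := by ext y; simp [mem_nbrsIn]
    rw [this] at hj
    simp at hj
    omega
  · have hYx : Y = {x} := by
      rw [Finset.eq_singleton_iff_unique_mem]
      exact ⟨hx, fun y hy => Finset.card_le_one.1 hY1 y hy x hx⟩
    have h1 := h.sparse i x (hY hx) j
    rw [← hYx, hB] at h1
    have h2 : (W : ℝ) ≤ 2 * (nbrsIn G Y (B j)).card := by exact_mod_cast hj
    have h3 : (0 : ℝ) < W := by exact_mod_cast hW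
    linarith

/-- At some size exactly, one of the two sides stops being thin. -/
theorem exists_thin {G : SimpleGraph V} {L₁ L₂ W₁ W₂ : ℕ} {A : Fin L₁ → Finset V}
    {B : Fin L₂ → Finset V} {lam : ℝ} (hA : ∀ i, (A i).card = W₁) (hB : ∀ j, (B j).card = W₂)
    (hW₁ : 0 < W₁) (hW₂ : 0 < W₂) (hL₁ : 0 < L₁) (hL₂ : 2 ≤ L₂) (hAB : IsRegularPair G A B lam)
    (hBA : IsRegularPair G B A lam) :
    ∃ s, 1 ≤ s ∧ IsThin G A B s ∧ IsThin G B A s ∧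
      (¬ IsThin G A B (s + 1) ∨ ¬ IsThin G B A (s + 1)) := by
  -- Size 1 is always thin, so the search starts at 2 and s is `Nat.find hex + 1`. It terminates
  -- since a quarter of a block, taken whole, already covers half of every block opposite.
  have hex : ∃ n, ¬ (IsThin G A B (n + 2) ∧ IsThin G B A (n + 2)) := by
    refine ⟨W₁, fun h => ?_⟩
    obtain ⟨C, hC, hCc, hCt⟩ := h.1 ⟨0, hL₁⟩
    refine hCt C (Finset.Subset.refl _) ?_ ⟨⟨1, by omega⟩, .inl rfl, hAB.dense _ C hC hCc _⟩
    have := Finset.card_le_card hC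
    rw [hA] at this
    omega
  have hspec := Nat.find_spec hex
  have hone := hAB.isThin_one hB hW₂
  have hone' := hBA.isThin_one hA hW₁
  refine ⟨Nat.find hex + 1, by omega, ?_, ?_, ?_⟩
  · rcases Nat.eq_zero_or_pos (Nat.find hex) with h0 | h0
    · rw [h0]; exact hone
    · have := Nat.find_min hex (m := Nat.find hex - 1) (by omega)
      rw [not_not] at this
      have he : Nat.find hex - 1 + 2 = Nat.find hex + 1 := by omega
      exact he ▸ this.1
  · rcases Nat.eq_zero_or_pos (Nat.find hex) with h0 | h0
    · rw [h0]; exact hone'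
    · have := Nat.find_min hex (m := Nat.find hex - 1) (by omega)
      rw [not_not] at this
      have he : Nat.find hex - 1 + 2 = Nat.find hex + 1 := by omega
      exact he ▸ this.2
  · exact not_and_or.1 hspec

theorem IsCopy.swap {ι₁ ι₂ : Type*} {G : SimpleGraph V} {T : SimpleGraph U} {U₁ U₂ : Set U}
    {A : ι₁ → Finset V} {B : ι₂ → Finset V} {X : Finset U} {φ : U → V} {p : U → ι₁} {q : U → ι₂}
    (h : IsCopy G T U₁ U₂ A B X φ p q) : IsCopy G T U₂ U₁ B A X φ q p :=
  ⟨h.memB, h.memA, h.injq, h.injp, fun u hu hu₂ v hv hv₁ => by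
    rw [SimpleGraph.adj_comm, h.adj v hv hv₁ u hu hu₂, SimpleGraph.adj_comm]⟩

theorem HasTransfer.swap {ι₁ ι₂ : Type*} {G : SimpleGraph V} {T : SimpleGraph U} {U₁ U₂ : Set U}
    {A : ι₁ → Finset V} {B : ι₂ → Finset V} {κ : ℝ} {τ : ℕ} {lt₁ : ι₁ → ι₁ → Prop}
    {lt₂ : ι₂ → ι₂ → Prop} (h : HasTransfer G T U₁ U₂ A B κ τ lt₁ lt₂) :
    HasTransfer G T U₂ U₁ B A κ τ lt₂ lt₁ := by
  intro X φ p q hX hc hτ hcopy A' B' hA hB hA' hB' I J hI hJ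
  obtain ⟨φ', p', q', h1, h2⟩ := h X φ q p hX hc hτ hcopy.swap B' A' hB hA hB' hA' J I hJ hI
  exact ⟨φ', q', p', h1.swap, h2.imageq, h2.imagep, h2.lt₂_iff, h2.lt₁_iff⟩

/-- Transfer does not see the direction of the orders, so an extreme block may be a first or a last
one. -/
theorem HasTransfer.reverse {ι₁ ι₂ : Type*} {G : SimpleGraph V} {T : SimpleGraph U} {U₁ U₂ : Set U}
    {A : ι₁ → Finset V} {B : ι₂ → Finset V} {κ : ℝ} {τ : ℕ} {lt₁ : ι₁ → ι₁ → Prop}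
    {lt₂ : ι₂ → ι₂ → Prop} (h : HasTransfer G T U₁ U₂ A B κ τ lt₁ lt₂) :
    HasTransfer G T U₁ U₂ A B κ τ (fun i j => lt₁ j i) lt₂ := by
  intro X φ p q hX hc hτ hcopy A' B' hA hB hA' hB' I J hI hJ
  obtain ⟨φ', p', q', h1, h2⟩ := h X φ p q hX hc hτ hcopy A' B' hA hB hA' hB' I J hI hJ
  exact ⟨φ', p', q', h1, h2.imagep, h2.imageq,
    fun u hu hu₁ v hv hv₁ => h2.lt₁_iff v hv hv₁ u hu hu₁, h2.lt₂_iff⟩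

/-- A regular family of blocks in which copies of subtrees can be moved contains every tree. -/
theorem exists_copy_of_isRegularPair [Fintype U] {G : SimpleGraph V} {L₁ L₂ : ℕ}
    {A : Fin L₁ → Finset V} {B : Fin L₂ → Finset V} {κ lam : ℝ} {τ W₁ W₂ : ℕ}
    (hA : ∀ i, (A i).card = W₁) (hB : ∀ j, (B j).card = W₂) (hW₁ : 0 < W₁) (hW₂ : 0 < W₂)
    (hκ : 0 < κ) (hκ' : κ ≤ 1 / 1000) (hlam : 0 < lam) (hlamτ : τ * lam ≤ κ) (hτ : 1 ≤ τ)
    (hL₁ : 2 * τ + 6 ≤ L₁) (hL₂ : 2 * τ + 6 ≤ L₂) (hAB : IsRegularPair G A B lam)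
    (hBA : IsRegularPair G B A lam) (T : SimpleGraph U) (hT : T.IsTree) (U₁ U₂ : Set U)
    (hU : Disjoint U₁ U₂) (hbip : ∀ u v, T.Adj u v → (u ∈ U₁ ∧ v ∈ U₂) ∨ (u ∈ U₂ ∧ v ∈ U₁))
    (hUτ : Fintype.card U ≤ τ) (htr : HasTransfer G T U₁ U₂ A B κ τ (· < ·) (· < ·)) :
    ∃ φ p q, IsCopy G T U₁ U₂ A B Finset.univ φ p q := by
  have hconn : ConnectedOn T ((Finset.univ : Finset U) : Set U) := by
    intro u _ v _
    have := (SimpleGraph.reachable_iff_reflTransGen u v).1 (hT.connected.preconnected u v)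
    exact Relation.ReflTransGen.mono (fun _ _ h => ⟨h, by simp⟩) _ _ this
  obtain ⟨u⟩ : Nonempty U := hT.connected.nonempty
  obtain ⟨s, hs, htA, htB, hnt⟩ := exists_thin hA hB hW₁ hW₂ (by omega) (by omega) hAB hBA
  have fix : ∀ {L M : ℕ} {A : Fin L → Finset V} {B : Fin M → Finset V} {U₁ U₂ : Set U}
      {lt₁ : Fin L → Fin L → Prop} {lt₂ : Fin M → Fin M → Prop},
      ((lt₁ = (· < ·)) ∨ lt₁ = (· > ·)) → ((lt₂ = (· < ·)) ∨ lt₂ = (· > ·)) →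
      HasTransfer G T U₁ U₂ A B κ τ (· < ·) (· < ·) → HasTransfer G T U₁ U₂ A B κ τ lt₁ lt₂ := by
    rintro L M A B U₁ U₂ lt₁ lt₂ (rfl | rfl) (rfl | rfl) h
    · exact h
    · exact h.swap.reverse.swap
    · exact h.reverse
    · exact h.reverse.swap.reverse.swap
  rcases hnt with hnt | hnt
  · obtain ⟨lt₁, lt₂, k, β, I₀, J₀, Am, Bm, D₀, hlt₁, hlt₂, hcore⟩ := exists_core_of_thin hA hB hW₁
      hW₂ hκ hκ' hlam hlamτ hτ hs hL₁ hL₂ hAB hBA htA htB hnt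
    obtain ⟨φ, p, q, hc, -⟩ := hcore.exists_copy_extreme T hT.isAcyclic U₁ U₂ hU hbip
      (fix hlt₁ hlt₂ htr) _ Finset.univ rfl hUτ hconn u (Finset.mem_univ _)
    exact ⟨φ, p, q, hc⟩
  · obtain ⟨lt₁, lt₂, k, β, I₀, J₀, Am, Bm, D₀, hlt₁, hlt₂, hcore⟩ := exists_core_of_thin hB hA hW₂
      hW₁ hκ hκ' hlam hlamτ hτ hs hL₂ hL₁ hBA hAB htB htA hnt
    obtain ⟨φ, p, q, hc, -⟩ := hcore.exists_copy_extreme T hT.isAcyclic U₂ U₁ hU.symm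
      (fun u v h => (hbip u v h).symm) (fix hlt₁ hlt₂ htr.swap) _ Finset.univ rfl hUτ hconn u
      (Finset.mem_univ _)
    exact ⟨φ, q, p, hc.swap⟩

end Selection

/-! ### The number of vertices of a tree of bounded degree and height. -/

section TreeSize

open scoped Classical

variable {U : Type*}

/-- The vertices at distance `d` from `r`. -/
noncomputable def sphere [Fintype U] (T : SimpleGraph U) (r : U) (d : ℕ) : Finset U :=
  Finset.univ.filter fun v => T.dist r v = d

theorem exists_pred (T : SimpleGraph U) (hT : T.Connected) (r v : U) (d : ℕ)
    (hd : T.dist r v = d + 1) : ∃ u, T.Adj u v ∧ T.dist r u = d := by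
  obtain ⟨p, hp⟩ := hT.exists_walk_length_eq_dist r v
  have hn : ¬ p.Nil := by
    intro h
    have := SimpleGraph.Walk.length_eq_zero_iff.2 h
    omega
  have hadj := p.adj_penultimate hn
  refine ⟨p.penultimate, hadj, ?_⟩
  have h1 : T.dist r p.penultimate ≤ p.dropLast.length := SimpleGraph.dist_le _
  have h2 : p.dropLast.length + 1 = p.length := p.length_dropLast_add_one hn
  have h3 := hT.dist_triangle (u := r) (v := p.penultimate) (w := v)
  rw [SimpleGraph.dist_eq_one_iff_adj.2 hadj] at h3
  omega

theorem card_sphere_succ_le [Fintype U] (T : SimpleGraph U) (hT : T.Connected) (r : U) (d c : ℕ)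
    (h : ∀ u ∈ sphere T r d,
      (Finset.univ.filter fun v => T.Adj u v ∧ T.dist r v = d + 1).card ≤ c) :
    (sphere T r (d + 1)).card ≤ (sphere T r d).card * c := by
  have hsub : sphere T r (d + 1) ⊆ (sphere T r d).biUnion fun u =>
      Finset.univ.filter fun v => T.Adj u v ∧ T.dist r v = d + 1 := by
    intro v hv
    have hv' := (Finset.mem_filter.1 hv).2
    obtain ⟨u, hu, hud⟩ := exists_pred T hT r v d hv'
    exact Finset.mem_biUnion.2 ⟨u, Finset.mem_filter.2 ⟨Finset.mem_univ _, hud⟩,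
      Finset.mem_filter.2 ⟨Finset.mem_univ _, hu, hv'⟩⟩
  exact (Finset.card_le_card hsub).trans (Finset.card_biUnion_le_card_mul _ _ _ h)

/-- The root has at most δ + 1 ≤ 2δ children; any other vertex has at most δ, since one of its
neighbours is closer to the root. -/
theorem card_sphere_le [Fintype U] (T : SimpleGraph U) (hT : T.Connected) (r : U) (δ : ℕ)
    (hδ : 1 ≤ δ) (hdeg : ∀ v, (T.neighborSet v).ncard ≤ δ + 1) (d : ℕ) :
    (sphere T r d).card ≤ 2 * δ ^ d := by
  have hdeg' : ∀ u, (Finset.univ.filter fun v => T.Adj u v).card ≤ δ + 1 := by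
    intro u
    refine le_trans (le_of_eq ?_) (hdeg u)
    rw [← Set.ncard_coe_finset]
    congr 1
    ext v
    simp
  have h0 : (sphere T r 0).card ≤ 1 := by
    refine Finset.card_le_one.2 fun x hx y hy => ?_
    have hx' := (hT.dist_eq_zero_iff).1 (Finset.mem_filter.1 hx).2
    have hy' := (hT.dist_eq_zero_iff).1 (Finset.mem_filter.1 hy).2
    rw [← hx', ← hy']
  rcases d with _ | d
  · simpa using h0.trans (by norm_num)
  induction d with
  | zero =>
    have := card_sphere_succ_le T hT r 0 (δ + 1) fun u _ =>
      (Finset.card_le_card (Finset.monotone_filter_right _ fun _ _ h => h.1)).trans (hdeg' u)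
    calc _ ≤ _ := this
      _ ≤ 1 * (δ + 1) := Nat.mul_le_mul_right _ h0
      _ ≤ _ := by simp only [zero_add, pow_one]; omega
  | succ d ih =>
    have := card_sphere_succ_le T hT r (d + 1) δ fun u hu => by
      have hu' := (Finset.mem_filter.1 hu).2
      obtain ⟨w, hw, hwd⟩ := exists_pred T hT r u d hu'
      have hlt : (Finset.univ.filter fun v => T.Adj u v ∧ T.dist r v = d + 1 + 1) ⊂
          Finset.univ.filter fun v => T.Adj u v := by
        refine Finset.ssubset_iff_subset_ne.2
          ⟨Finset.monotone_filter_right _ fun _ _ h => h.1, fun he => ?_⟩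
        have hmem : w ∈ Finset.univ.filter fun v => T.Adj u v :=
          Finset.mem_filter.2 ⟨Finset.mem_univ _, hw.symm⟩
        rw [← he] at hmem
        have := (Finset.mem_filter.1 hmem).2.2
        omega
      have := Finset.card_lt_card hlt
      have := hdeg' u
      omega
    calc _ ≤ _ := this
      _ ≤ (2 * δ ^ (d + 1)) * δ := Nat.mul_le_mul_right _ ih
      _ = _ := by ring

/-- A vertex of a tree at maximum distance from the root is a leaf. -/
theorem ncard_neighborSet_eq_one_of_dist_max (T : SimpleGraph U) (hT : T.IsTree) (r v : U)
    (hmax : ∀ w, T.dist r w ≤ T.dist r v) (hne : r ≠ v) : (T.neighborSet v).ncard = 1 := by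
  have hpos : 0 < T.dist r v := hT.connected.pos_dist_of_ne hne
  obtain ⟨u, hu, -⟩ := exists_pred T hT.connected r v (T.dist r v - 1) (by omega)
  -- A shortest path to a neighbour w of v avoids v, as otherwise v would be closer to r than w.
  -- Extending such paths for two neighbours gives two paths from r to v, which coincide in a tree.
  have key : ∀ w, T.Adj w v → ∃ p : T.Walk r w, p.IsPath ∧ v ∉ p.support := by
    intro w hw
    obtain ⟨p, hp⟩ := hT.connected.exists_walk_length_eq_dist r w
    refine ⟨p, p.isPath_of_length_eq_dist hp, fun hv => ?_⟩
    have h1 := SimpleGraph.Walk.length_takeUntil_lt_length hv hw.ne'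
    have h2 := SimpleGraph.dist_le (p.takeUntil v hv)
    have h3 := hmax w
    omega
  refine Set.ncard_eq_one.2 ⟨u, ?_⟩
  ext w
  simp only [SimpleGraph.mem_neighborSet, Set.mem_singleton_iff]
  refine ⟨fun hw => ?_, fun hw => hw ▸ hu.symm⟩
  obtain ⟨p, hp, hvp⟩ := key u hu
  obtain ⟨q, hq, hvq⟩ := key w hw.symm
  have he := (hT.isAcyclic.subsingleton_path r v).elim ⟨_, hp.concat hvp hu⟩
    ⟨_, hq.concat hvq hw.symm⟩
  obtain ⟨h, -⟩ := SimpleGraph.Walk.concat_inj (congrArg Subtype.val he)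
  exact h.symm

/-- A tree of maximum degree at most `δ + 1` and height less than `η` has at most `δ ^ (η + 1)`
vertices. -/
theorem card_le_of_height [Fintype U] (T : SimpleGraph U) (hT : T.IsTree) (r : U) (δ η : ℕ)
    (hδ : 2 ≤ δ) (hdeg : ∀ v, (T.neighborSet v).ncard ≤ δ + 1)
    (hpath : ∀ (v : U) (p : T.Walk r v), (T.neighborSet v).ncard = 1 → p.IsPath → p.length < η) :
    Fintype.card U ≤ δ ^ (η + 1) := by
  have : Nonempty U := ⟨r⟩
  obtain ⟨v, hv⟩ := Finite.exists_max fun v => T.dist r v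
  -- A one-vertex tree has no leaf, so the bound on path lengths does not apply to it.
  by_cases hrv : r = v
  · have hone : Fintype.card U ≤ 1 := by
      refine Fintype.card_le_one_iff.2 fun x y => ?_
      have hz : ∀ x, r = x := fun x => by
        have := hv x
        rw [← hrv, SimpleGraph.dist_self] at this
        exact hT.connected.dist_eq_zero_iff.1 (by omega)
      rw [← hz x, ← hz y]
    exact hone.trans (Nat.one_le_pow _ _ (by omega))
  · have hleaf := ncard_neighborSet_eq_one_of_dist_max T hT r v hv hrv
    obtain ⟨p, hp⟩ := hT.connected.exists_walk_length_eq_dist r v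
    have hη := hpath v p hleaf (p.isPath_of_length_eq_dist hp)
    have hcover : (Finset.univ : Finset U) ⊆ (Finset.range η).biUnion (sphere T r) := by
      intro w _
      have := hv w
      exact Finset.mem_biUnion.2 ⟨T.dist r w, Finset.mem_range.2 (by omega),
        Finset.mem_filter.2 ⟨Finset.mem_univ _, rfl⟩⟩
    have hgeom : ∀ n, ∑ d ∈ Finset.range n, 2 * δ ^ d ≤ 2 * δ ^ n := by
      intro n
      induction n with
      | zero => simp
      | succ n ih =>
        rw [Finset.sum_range_succ]
        calc _ ≤ 2 * δ ^ n + 2 * δ ^ n := Nat.add_le_add_right ih _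
          _ = 2 * (δ ^ n * 2) := by ring
          _ ≤ 2 * (δ ^ n * δ) := by gcongr
          _ = _ := by ring
    calc Fintype.card U = (Finset.univ : Finset U).card := rfl
      _ ≤ ∑ d ∈ Finset.range η, (sphere T r d).card :=
        (Finset.card_le_card hcover).trans Finset.card_biUnion_le
      _ ≤ ∑ d ∈ Finset.range η, 2 * δ ^ d :=
        Finset.sum_le_sum fun d _ => card_sphere_le T hT.connected r δ (by omega) hdeg d
      _ ≤ 2 * δ ^ η := hgeom η
      _ ≤ δ * δ ^ η := Nat.mul_le_mul_right _ hδ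
      _ = δ ^ (η + 1) := by ring

end TreeSize

/-! ### Transfer of copies from support-uniformity and support-invariance. -/

section Transfer

open scoped Classical

variable {U V W : Type*}

theorem mem_V₂_iff_notMem_V₁ (G : Bigraph V) (v : V) : v ∈ G.V₂ ↔ v ∉ G.V₁ := by
  rw [← Set.mem_compl_iff, G.isCompl.compl_eq]

/-- The blocks of a parade on the first side, as finsets. -/
noncomputable def Parade.finA [Finite V] {G : Bigraph V} {K L : ℕ} (P : Parade G K L) (i : Fin K) :
    Finset V := (P.A i).toFinite.toFinset

/-- The blocks of a parade on the second side, as finsets. -/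
noncomputable def Parade.finB [Finite V] {G : Bigraph V} {K L : ℕ} (P : Parade G K L) (j : Fin L) :
    Finset V := (P.B j).toFinite.toFinset

section

variable {G : Bigraph V} {K L : ℕ} {P : Parade G K L}

theorem Parade.A_index_unique {v : V} {i i' : Fin K} (h : v ∈ P.A i) (h' : v ∈ P.A i') : i = i' := by
  by_contra hne
  exact Set.disjoint_left.1 (P.A_disjoint i i' hne) h h'

theorem Parade.B_index_unique {v : V} {j j' : Fin L} (h : v ∈ P.B j) (h' : v ∈ P.B j') : j = j' := by
  by_contra hne
  exact Set.disjoint_left.1 (P.B_disjoint j j' hne) h h'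

variable [Finite V]

@[simp] theorem Parade.mem_finA {i : Fin K} {v : V} : v ∈ P.finA i ↔ v ∈ P.A i := by
  simp [Parade.finA]

@[simp] theorem Parade.mem_finB {j : Fin L} {v : V} : v ∈ P.finB j ↔ v ∈ P.B j := by
  simp [Parade.finB]

@[simp] theorem Parade.card_finA (i : Fin K) : (P.finA i).card = (P.A i).ncard := by
  rw [Parade.finA, Set.ncard_eq_toFinset_card]

@[simp] theorem Parade.card_finB (j : Fin L) : (P.finB j).card = (P.B j).ncard := by
  rw [Parade.finB, Set.ncard_eq_toFinset_card]

variable {T : Bigraph U} {X : Finset U} {φ : U → V} {p : U → Fin K} {q : U → Fin L}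

theorem IsCopy.mem_V₁_iff (h : IsCopy G.graph T.graph T.V₁ T.V₂ P.finA P.finB X φ p q) {u : U}
    (hu : u ∈ X) : φ u ∈ G.V₁ ↔ u ∈ T.V₁ := by
  by_cases hu₁ : u ∈ T.V₁
  · exact ⟨fun _ => hu₁, fun _ => P.A_subset _ (Parade.mem_finA.1 (h.memA u hu hu₁))⟩
  · have := P.B_subset _ (Parade.mem_finB.1 (h.memB u hu ((mem_V₂_iff_notMem_V₁ T u).2 hu₁)))
    exact ⟨fun h' => absurd h' ((mem_V₂_iff_notMem_V₁ G _).1 this), fun h' => absurd h' hu₁⟩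

theorem IsCopy.mem_A_iff (h : IsCopy G.graph T.graph T.V₁ T.V₂ P.finA P.finB X φ p q) {u : U}
    (hu : u ∈ X) (i : Fin K) : φ u ∈ P.A i ↔ u ∈ T.V₁ ∧ p u = i := by
  refine ⟨fun hi => ?_, fun hi => ?_⟩
  · have hu₁ := (h.mem_V₁_iff hu).1 (P.A_subset _ hi)
    exact ⟨hu₁, Parade.A_index_unique (Parade.mem_finA.1 (h.memA u hu hu₁)) hi⟩
  · rw [← hi.2]
    exact Parade.mem_finA.1 (h.memA u hu hi.1)

theorem IsCopy.mem_B_iff (h : IsCopy G.graph T.graph T.V₁ T.V₂ P.finA P.finB X φ p q) {u : U}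
    (hu : u ∈ X) (j : Fin L) : φ u ∈ P.B j ↔ u ∈ T.V₂ ∧ q u = j := by
  refine ⟨fun hi => ?_, fun hi => ?_⟩
  · have hu₂ : u ∈ T.V₂ := (mem_V₂_iff_notMem_V₁ T u).2 fun hu₁ =>
      (mem_V₂_iff_notMem_V₁ G _).1 (P.B_subset _ hi) ((h.mem_V₁_iff hu).2 hu₁)
    exact ⟨hu₂, Parade.B_index_unique (Parade.mem_finB.1 (h.memB u hu hu₂)) hi⟩
  · rw [← hi.2]
    exact Parade.mem_finB.1 (h.memB u hu hi.1)

theorem IsCopy.injOn (h : IsCopy G.graph T.graph T.V₁ T.V₂ P.finA P.finB X φ p q) :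
    Set.InjOn φ (X : Set U) := by
  intro u hu v hv huv
  by_cases hu₁ : u ∈ T.V₁
  · have hv₁ : v ∈ T.V₁ := (h.mem_V₁_iff hv).1 (huv ▸ (h.mem_V₁_iff hu).2 hu₁)
    refine h.injp u hu hu₁ v hv hv₁ ?_
    exact ((h.mem_A_iff hu (p v)).1 (huv ▸ (h.mem_A_iff hv (p v)).2 ⟨hv₁, rfl⟩)).2
  · have hv₁ : v ∉ T.V₁ := fun hv₁ => hu₁ ((h.mem_V₁_iff hu).1 (huv ▸ (h.mem_V₁_iff hv).2 hv₁))
    have hu₂ := (mem_V₂_iff_notMem_V₁ T u).2 hu₁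
    have hv₂ := (mem_V₂_iff_notMem_V₁ T v).2 hv₁
    refine h.injq u hu hu₂ v hv hv₂ ?_
    exact ((h.mem_B_iff hu (q v)).1 (huv ▸ (h.mem_B_iff hv (q v)).2 ⟨hv₂, rfl⟩)).2

theorem IsCopy.isRainbow (h : IsCopy G.graph T.graph T.V₁ T.V₂ P.finA P.finB X φ p q) :
    P.IsRainbow (φ '' X) := by
  refine ⟨?_, fun i => ?_, fun j => ?_⟩
  · rintro _ ⟨u, hu, rfl⟩
    by_cases hu₁ : u ∈ T.V₁
    · exact .inl ⟨_, Parade.mem_finA.1 (h.memA u hu hu₁)⟩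
    · exact .inr ⟨_, Parade.mem_finB.1 (h.memB u hu ((mem_V₂_iff_notMem_V₁ T u).2 hu₁))⟩
  · rintro _ ⟨⟨u, hu, rfl⟩, hui⟩ _ ⟨⟨v, hv, rfl⟩, hvi⟩
    have h1 := (h.mem_A_iff hu i).1 hui
    have h2 := (h.mem_A_iff hv i).1 hvi
    rw [h.injp u hu h1.1 v hv h2.1 (h1.2.trans h2.2.symm)]
  · rintro _ ⟨⟨u, hu, rfl⟩, hui⟩ _ ⟨⟨v, hv, rfl⟩, hvi⟩
    have h1 := (h.mem_B_iff hu j).1 hui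
    have h2 := (h.mem_B_iff hv j).1 hvi
    rw [h.injq u hu h1.1 v hv h2.1 (h1.2.trans h2.2.symm)]

/-- `IsCopy` compares adjacency only across the bipartition; two vertices on the same side are
nonadjacent in both bigraphs. -/
theorem IsCopy.adj_iff (h : IsCopy G.graph T.graph T.V₁ T.V₂ P.finA P.finB X φ p q) {u v : U}
    (hu : u ∈ X) (hv : v ∈ X) : G.graph.Adj (φ u) (φ v) ↔ T.graph.Adj u v := by
  have hGno : ∀ x y, (x ∈ G.V₁ ↔ y ∈ G.V₁) → ¬ G.graph.Adj x y := fun x y hxy hadj => by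
    rcases G.isBipartiteWith.2 hadj with ⟨h1, h2⟩ | ⟨h1, h2⟩
    · exact (mem_V₂_iff_notMem_V₁ G _).1 h2 (hxy.1 h1)
    · exact (mem_V₂_iff_notMem_V₁ G _).1 h1 (hxy.2 h2)
  have hTno : ∀ x y, (x ∈ T.V₁ ↔ y ∈ T.V₁) → ¬ T.graph.Adj x y := fun x y hxy hadj => by
    rcases T.isBipartiteWith.2 hadj with ⟨h1, h2⟩ | ⟨h1, h2⟩
    · exact (mem_V₂_iff_notMem_V₁ T _).1 h2 (hxy.1 h1)
    · exact (mem_V₂_iff_notMem_V₁ T _).1 h1 (hxy.2 h2)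
  by_cases huv : u ∈ T.V₁ ↔ v ∈ T.V₁
  · have := hGno (φ u) (φ v) (by rw [h.mem_V₁_iff hu, h.mem_V₁_iff hv, huv])
    exact ⟨fun h' => absurd h' this, fun h' => absurd h' (hTno _ _ huv)⟩
  · by_cases hu₁ : u ∈ T.V₁
    · have hv₁ : v ∉ T.V₁ := fun hv₁ => huv ⟨fun _ => hv₁, fun _ => hu₁⟩
      exact h.adj u hu hu₁ v hv ((mem_V₂_iff_notMem_V₁ T v).2 hv₁)
    · have hv₁ : v ∈ T.V₁ := by tauto
      rw [SimpleGraph.adj_comm, h.adj v hv hv₁ u hu ((mem_V₂_iff_notMem_V₁ T u).2 hu₁),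
        SimpleGraph.adj_comm]

/-- A copy of `T[X]` gives an isomorphism from any bigraph that is identified with `T[X]`. -/
theorem IsCopy.exists_iso (h : IsCopy G.graph T.graph T.V₁ T.V₂ P.finA P.finB X φ p q)
    (H : Bigraph W) (e : W → U) (he : Function.Injective e) (hrange : ∀ u, u ∈ X ↔ ∃ w, e w = u)
    (hadj : ∀ a b, H.graph.Adj a b ↔ T.graph.Adj (e a) (e b))
    (hV₁ : ∀ a, a ∈ H.V₁ ↔ e a ∈ T.V₁) :
    ∃ iso : H.Iso (G.induce (φ '' X)), ∀ w, (iso.toGraphIso w : V) = φ (e w) := by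
  have heX : ∀ w, e w ∈ X := fun w => (hrange _).2 ⟨w, rfl⟩
  let f : W → ↥(φ '' (X : Set U)) := fun w => ⟨φ (e w), e w, heX w, rfl⟩
  have hf : Function.Bijective f := by
    refine ⟨fun a b hab => he (h.injOn (heX a) (heX b) (congrArg Subtype.val hab)), ?_⟩
    rintro ⟨_, u, hu, rfl⟩
    obtain ⟨w, rfl⟩ := (hrange u).1 hu
    exact ⟨w, rfl⟩
  have h₁ : ∀ w, φ (e w) ∈ G.V₁ ↔ w ∈ H.V₁ := fun w => by rw [h.mem_V₁_iff (heX w), hV₁]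
  refine ⟨⟨⟨Equiv.ofBijective f hf, ?_⟩, ?_, ?_⟩, fun w => rfl⟩
  · intro a b
    exact (h.adj_iff (heX a) (heX b)).trans (hadj a b).symm
  · exact h₁
  · intro w
    change φ (e w) ∈ G.V₂ ↔ _
    rw [mem_V₂_iff_notMem_V₁, mem_V₂_iff_notMem_V₁, h₁]

end

/-- The ordered bigraph obtained from a bigraph by pulling back along an injection, ordered by
functions that are injective on the two sides. -/
def orderedComap (T : Bigraph U) (e : W → U) {ι₁ ι₂ : Type*} [LinearOrder ι₁] [LinearOrder ι₂]
    (p : U → ι₁) (q : U → ι₂)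
    (hp : Function.Injective fun w : {w | e w ∈ T.V₁} => p (e w))
    (hq : Function.Injective fun w : {w | e w ∈ T.V₂} => q (e w)) : OrderedBigraph W where
  graph := T.graph.comap e
  V₁ := {w | e w ∈ T.V₁}
  V₂ := {w | e w ∈ T.V₂}
  isCompl := ⟨Set.disjoint_left.2 fun _ h₁ h₂ => Set.disjoint_left.1 T.isCompl.disjoint h₁ h₂,
    codisjoint_iff_le_sup.2 fun x _ =>
      (codisjoint_iff_le_sup.1 T.isCompl.codisjoint (Set.mem_univ (e x)))⟩
  isBipartiteWith := ⟨Set.disjoint_left.2 fun _ h₁ h₂ =>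
    Set.disjoint_left.1 T.isCompl.disjoint h₁ h₂, fun _ _ h => T.isBipartiteWith.2 h⟩
  lt₁ := fun a b => p (e a) < p (e b)
  lt₂ := fun a b => q (e a) < q (e b)
  isStrictTotalOrder₁ := (RelEmbedding.preimage ⟨_, hp⟩ (· < ·)).isStrictTotalOrder
  isStrictTotalOrder₂ := (RelEmbedding.preimage ⟨_, hq⟩ (· < ·)).isStrictTotalOrder

theorem isTree_comap (T : SimpleGraph U) (hT : T.IsAcyclic) (X : Set U) (hX : ConnectedOn T X)
    (e : W → U) (he : Function.Injective e) (hrange : ∀ u, u ∈ X ↔ ∃ w, e w = u) (hne : X.Nonempty) :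
    (T.comap e).IsTree := by
  have hpre : (T.comap e).Preconnected := by
    intro a b
    have key : ∀ y, Relation.ReflTransGen (fun x y => T.Adj x y ∧ y ∈ X) (e a) y →
        ∃ b, e b = y ∧ (T.comap e).Reachable a b := by
      intro y h
      induction h with
      | refl => exact ⟨a, rfl, .refl _⟩
      | tail _ h ih =>
        obtain ⟨c, rfl, hc⟩ := ih
        obtain ⟨d, rfl⟩ := (hrange _).1 h.2
        exact ⟨d, rfl, hc.trans (SimpleGraph.Adj.reachable h.1)⟩
    obtain ⟨c, hc, hac⟩ := key (e b) (hX _ ((hrange _).2 ⟨a, rfl⟩) _ ((hrange _).2 ⟨b, rfl⟩))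
    exact he hc ▸ hac
  obtain ⟨u, hu⟩ := hne
  obtain ⟨w, -⟩ := (hrange u).1 hu
  exact { preconnected := hpre, nonempty := ⟨w⟩, isAcyclic := hT.comap ⟨e, fun h => h⟩ he }

theorem image_eq_of_mem_iff {ι : Type*} (F : Finset U) (f : U → ι) (I : Finset ι)
    (h : ∀ i, (∃ u ∈ F, f u = i) ↔ i ∈ I) : F.image f = I := by
  ext i
  rw [Finset.mem_image, h]

/-- Support-uniformity and support-invariance allow copies of small subtrees to be moved. -/
theorem hasTransfer_of_parade [Finite V] {G : Bigraph V} {K L : ℕ} (P : Parade G K L)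
    (hK : 0 < K) (hL : 0 < L) (T : Bigraph U) (hT : T.graph.IsAcyclic) (κ : ℝ) (τ : ℕ) (hκ : 0 < κ)
    (hinvariant : P.IsSupportInvariant κ τ) (huniform : P.IsSupportUniform τ) :
    HasTransfer G.graph T.graph T.V₁ T.V₂ P.finA P.finB κ τ (· < ·) (· < ·) := by
  intro X φ p q hX hc hτ hcopy A' B' hA hB hA' hB' I J hI hJ
  -- The subtree is relabelled by `Fin n` because support-uniformity quantifies over `Type`, whereas
  -- U lies in an arbitrary universe.
  obtain ⟨n, hn⟩ : ∃ n, n = X.card := ⟨_, rfl⟩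
  obtain ⟨e⟩ : Nonempty (Fin n ≃ X) := ⟨(finCongr hn).trans X.equivFin.symm⟩
  have heinj : Function.Injective fun i => (e i : U) :=
    fun a b h => e.injective (Subtype.ext h)
  have hrange : ∀ u, u ∈ X ↔ ∃ w, (e w : U) = u := fun u =>
    ⟨fun hu => ⟨e.symm ⟨u, hu⟩, by simp⟩, fun ⟨w, hw⟩ => hw ▸ (e w).2⟩
  let S : OrderedBigraph (Fin n) := orderedComap T (fun i => (e i : U)) p q
    (fun a b h => Subtype.ext (heinj (hcopy.injp _ (e a).2 a.2 _ (e b).2 b.2 h)))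
    (fun a b h => Subtype.ext (heinj (hcopy.injq _ (e a).2 a.2 _ (e b).2 b.2 h)))
  have hStree : S.graph.IsTree := isTree_comap T.graph hT X hc _ heinj hrange hX
  have hScard : Nat.card (Fin n) ≤ τ := by simpa [hn] using hτ
  have hSncard : ∀ (Q : Set U), {w | (e w : U) ∈ Q}.ncard = (X.filter (· ∈ Q)).card := by
    intro Q
    rw [← Set.ncard_image_of_injective _ heinj, ← Set.ncard_coe_finset]
    congr 1
    ext u
    simp only [Set.mem_image, Set.mem_ofPred_eq, Finset.coe_filter]
    refine ⟨?_, fun h => ?_⟩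
    · rintro ⟨w, hw, rfl⟩
      exact ⟨(e w).2, hw⟩
    · obtain ⟨w, rfl⟩ := (hrange u).1 h.1
      exact ⟨w, h.2, rfl⟩
  -- `S` has a copy in `P`
  have hne : P.trace S ≠ ∅ := by
    obtain ⟨iso, hiso⟩ := hcopy.exists_iso S.toBigraph _ heinj hrange (fun _ _ => Iff.rfl)
      (fun _ => Iff.rfl)
    refine Set.nonempty_iff_ne_empty.1 ⟨_, φ '' X, ⟨hcopy.isRainbow, iso, ?_, ?_⟩, rfl⟩
    · intro a b
      rw [hiso, hiso]
      constructor
      · intro h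
        exact ⟨_, _, h, (hcopy.mem_A_iff (e a).2 _).2 ⟨a.2, rfl⟩,
          (hcopy.mem_A_iff (e b).2 _).2 ⟨b.2, rfl⟩⟩
      · rintro ⟨i, j, hij, ha, hb⟩
        rw [hcopy.mem_A_iff (e _).2] at ha hb
        change p _ < p _
        rwa [ha.2, hb.2]
    · intro a b
      rw [hiso, hiso]
      constructor
      · intro h
        exact ⟨_, _, h, (hcopy.mem_B_iff (e a).2 _).2 ⟨a.2, rfl⟩,
          (hcopy.mem_B_iff (e b).2 _).2 ⟨b.2, rfl⟩⟩
      · rintro ⟨i, j, hij, ha, hb⟩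
        rw [hcopy.mem_B_iff (e _).2] at ha hb
        change q _ < q _
        rwa [ha.2, hb.2]
  have htrace := (huniform _ S hStree hScard).resolve_left hne
  -- subblocks of equal sizes
  set c₁ := ⌈κ * ((P.A ⟨0, hK⟩).ncard : ℝ)⌉₊ with hc₁
  set c₂ := ⌈κ * ((P.B ⟨0, hL⟩).ncard : ℝ)⌉₊ with hc₂
  have hc₁pos : 0 < c₁ := Nat.ceil_pos.2 (mul_pos hκ
    (Nat.cast_pos.2 ((Set.ncard_pos (Set.toFinite _)).2 (P.A_nonempty _))))
  have hc₂pos : 0 < c₂ := Nat.ceil_pos.2 (mul_pos hκ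
    (Nat.cast_pos.2 ((Set.ncard_pos (Set.toFinite _)).2 (P.B_nonempty _))))
  -- The blocks of a parade have equal sizes on each side, so the given subblocks are trimmed to the
  -- least admissible size.
  have hexA : ∀ i, ∃ C ⊆ A' i, C.card = c₁ := fun i =>
    Finset.exists_subset_card_eq (Nat.ceil_le.2 (by
      rw [P.A_ncard _ i, ← Parade.card_finA]
      exact hA' i))
  have hexB : ∀ j, ∃ C ⊆ B' j, C.card = c₂ := fun j =>
    Finset.exists_subset_card_eq (Nat.ceil_le.2 (by
      rw [P.B_ncard _ j, ← Parade.card_finB]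
      exact hB' j))
  choose CA hCA hCAc using hexA
  choose CB hCB hCBc using hexB
  have hCAP : ∀ i, (CA i : Set V) ⊆ P.A i := fun i v hv => Parade.mem_finA.1 (hA i (hCA i hv))
  have hCBP : ∀ j, (CB j : Set V) ⊆ P.B j := fun j v hv => Parade.mem_finB.1 (hB j (hCB j hv))
  let P' : Parade G K L :=
    { A := fun i => CA i
      B := fun j => CB j
      A_nonempty := fun i => Finset.card_pos.1 (by rw [hCAc]; exact hc₁pos)
      B_nonempty := fun j => Finset.card_pos.1 (by rw [hCBc]; exact hc₂pos)
      A_subset := fun i => (hCAP i).trans (P.A_subset i)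
      B_subset := fun j => (hCBP j).trans (P.B_subset j)
      A_disjoint := fun i i' h => (P.A_disjoint i i' h).mono (hCAP i) (hCAP i')
      B_disjoint := fun j j' h => (P.B_disjoint j j' h).mono (hCBP j) (hCBP j')
      A_ncard := fun i i' => by rw [Set.ncard_coe_finset, Set.ncard_coe_finset, hCAc, hCAc]
      B_ncard := fun j j' => by rw [Set.ncard_coe_finset, Set.ncard_coe_finset, hCBc, hCBc] }
  have hinv := hinvariant P' ⟨hCAP, hCBP⟩ (fun i => by
      change _ ≤ (((CA i : Set V).ncard : ℕ) : ℝ)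
      rw [Set.ncard_coe_finset, hCAc, P.A_ncard i ⟨0, hK⟩]
      exact Nat.le_ceil _) (fun j => by
      change _ ≤ (((CB j : Set V).ncard : ℕ) : ℝ)
      rw [Set.ncard_coe_finset, hCBc, P.B_ncard j ⟨0, hL⟩]
      exact Nat.le_ceil _) _ S hStree hScard
  -- By uniformity every support of the right size occurs for `P`; by invariance it also occurs for
  -- the trimmed parade.
  have hmem : ((I : Set (Fin K)), (J : Set (Fin L))) ∈ P'.trace S := by
    rw [← hinv, htrace]
    refine ⟨?_, ?_⟩
    · rw [Set.ncard_coe_finset, hI]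
      exact (hSncard T.V₁).symm
    · rw [Set.ncard_coe_finset, hJ]
      exact (hSncard T.V₂).symm
  obtain ⟨Y, ⟨⟨hYmem, hYA, hYB⟩, iso, hlt₁, hlt₂⟩, hsupp⟩ := hmem
  have hsuppI : ∀ i, (Y ∩ P'.A i).Nonempty ↔ i ∈ I := fun i => by
    have := congrArg Prod.fst hsupp
    exact Set.ext_iff.1 this i
  have hsuppJ : ∀ j, (Y ∩ P'.B j).Nonempty ↔ j ∈ J := fun j => by
    have := congrArg Prod.snd hsupp
    exact Set.ext_iff.1 this j
  -- the copy read off from the isomorphism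
  let φ' : U → V := fun u => if hu : u ∈ X then (iso.toGraphIso (e.symm ⟨u, hu⟩) : V) else φ u
  have hφ' : ∀ w, φ' (e w) = (iso.toGraphIso w : V) := fun w => by simp [φ']
  have hex₁ : ∀ u, ∃ i, u ∈ X → u ∈ T.V₁ → φ' u ∈ P'.A i := by
    intro u
    by_cases hu : u ∈ X ∧ u ∈ T.V₁
    · obtain ⟨w, rfl⟩ := (hrange u).1 hu.1
      have h1 : (iso.toGraphIso w : V) ∈ G.V₁ := (iso.mem_V₁_iff w).2 hu.2
      rcases hYmem _ (iso.toGraphIso w).2 with ⟨i, hi⟩ | ⟨j, hj⟩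
      · exact ⟨i, fun _ _ => by rw [hφ']; exact hi⟩
      · exact absurd h1 ((mem_V₂_iff_notMem_V₁ G _).1 (P'.B_subset j hj))
    · exact ⟨p u, fun h h' => absurd ⟨h, h'⟩ hu⟩
  have hex₂ : ∀ u, ∃ j, u ∈ X → u ∈ T.V₂ → φ' u ∈ P'.B j := by
    intro u
    by_cases hu : u ∈ X ∧ u ∈ T.V₂
    · obtain ⟨w, rfl⟩ := (hrange u).1 hu.1
      have h1 : (iso.toGraphIso w : V) ∈ G.V₂ := (iso.mem_V₂_iff w).2 hu.2
      rcases hYmem _ (iso.toGraphIso w).2 with ⟨i, hi⟩ | ⟨j, hj⟩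
      · exact absurd (P'.A_subset i hi) ((mem_V₂_iff_notMem_V₁ G _).1 h1)
      · exact ⟨j, fun _ _ => by rw [hφ']; exact hj⟩
    · exact ⟨q u, fun h h' => absurd ⟨h, h'⟩ hu⟩
  choose p' hp' using hex₁
  choose q' hq' using hex₂
  have hYof : ∀ w, φ' (e w) ∈ Y := fun w => by rw [hφ']; exact (iso.toGraphIso w).2
  have hφinj : ∀ a b, φ' (e a) = φ' (e b) → (e a : U) = e b := by
    intro a b h
    rw [hφ', hφ'] at h
    rw [iso.toGraphIso.injective (Subtype.ext h)]
  refine ⟨φ', p', q', ⟨?_, ?_, ?_, ?_, ?_⟩, ⟨?_, ?_, ?_, ?_⟩⟩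
  · exact fun u hu hu₁ => hCA _ (hp' u hu hu₁)
  · exact fun u hu hu₂ => hCB _ (hq' u hu hu₂)
  · intro u hu hu₁ v hv hv₁ huv
    have h1 := hp' u hu hu₁
    have h2 := hp' v hv hv₁
    rw [huv] at h1
    obtain ⟨a, rfl⟩ := (hrange u).1 hu
    obtain ⟨b, rfl⟩ := (hrange v).1 hv
    exact hφinj a b (hYA _ ⟨hYof a, h1⟩ ⟨hYof b, h2⟩)
  · intro u hu hu₁ v hv hv₁ huv
    have h1 := hq' u hu hu₁
    have h2 := hq' v hv hv₁
    rw [huv] at h1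
    obtain ⟨a, rfl⟩ := (hrange u).1 hu
    obtain ⟨b, rfl⟩ := (hrange v).1 hv
    exact hφinj a b (hYB _ ⟨hYof a, h1⟩ ⟨hYof b, h2⟩)
  · intro u hu _ v hv _
    obtain ⟨a, rfl⟩ := (hrange u).1 hu
    obtain ⟨b, rfl⟩ := (hrange v).1 hv
    rw [hφ', hφ']
    exact iso.toGraphIso.map_adj_iff (v := a) (w := b)
  · refine image_eq_of_mem_iff _ _ _ fun i => ?_
    rw [← hsuppI]
    constructor
    · rintro ⟨u, hu, rfl⟩
      obtain ⟨hu, hu₁⟩ := Finset.mem_filter.1 hu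
      obtain ⟨a, rfl⟩ := (hrange u).1 hu
      exact ⟨_, hYof a, hp' _ hu hu₁⟩
    · rintro ⟨y, hy, hyi⟩
      obtain ⟨a, ha⟩ := iso.toGraphIso.surjective ⟨y, hy⟩
      have hay : φ' (e a) = y := by rw [hφ', ha]
      have ha₁ : (e a : U) ∈ T.V₁ := (iso.mem_V₁_iff a).1 (by
        rw [ha]; exact P'.A_subset i hyi)
      refine ⟨e a, Finset.mem_filter.2 ⟨(e a).2, ha₁⟩, ?_⟩
      exact Parade.A_index_unique (hp' _ (e a).2 ha₁) (hay ▸ hyi)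
  · refine image_eq_of_mem_iff _ _ _ fun j => ?_
    rw [← hsuppJ]
    constructor
    · rintro ⟨u, hu, rfl⟩
      obtain ⟨hu, hu₁⟩ := Finset.mem_filter.1 hu
      obtain ⟨a, rfl⟩ := (hrange u).1 hu
      exact ⟨_, hYof a, hq' _ hu hu₁⟩
    · rintro ⟨y, hy, hyi⟩
      obtain ⟨a, ha⟩ := iso.toGraphIso.surjective ⟨y, hy⟩
      have hay : φ' (e a) = y := by rw [hφ', ha]
      have ha₁ : (e a : U) ∈ T.V₂ := (iso.mem_V₂_iff a).1 (by
        rw [ha]; exact P'.B_subset j hyi)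
      refine ⟨e a, Finset.mem_filter.2 ⟨(e a).2, ha₁⟩, ?_⟩
      exact Parade.B_index_unique (hq' _ (e a).2 ha₁) (hay ▸ hyi)
  · intro u hu hu₁ v hv hv₁
    have h1 := hp' u hu hu₁
    have h2 := hp' v hv hv₁
    obtain ⟨a, rfl⟩ := (hrange u).1 hu
    obtain ⟨b, rfl⟩ := (hrange v).1 hv
    refine (hlt₁ ⟨a, hu₁⟩ ⟨b, hv₁⟩).trans ?_
    rw [← hφ', ← hφ']
    refine ⟨fun ⟨i, j, hij, hi, hj⟩ => ?_, fun h => ⟨_, _, h, h1, h2⟩⟩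
    rw [Parade.A_index_unique h1 hi, Parade.A_index_unique h2 hj]
    exact hij
  · intro u hu hu₁ v hv hv₁
    have h1 := hq' u hu hu₁
    have h2 := hq' v hv hv₁
    obtain ⟨a, rfl⟩ := (hrange u).1 hu
    obtain ⟨b, rfl⟩ := (hrange v).1 hv
    refine (hlt₂ ⟨a, hu₁⟩ ⟨b, hv₁⟩).trans ?_
    rw [← hφ', ← hφ']
    refine ⟨fun ⟨i, j, hij, hi, hj⟩ => ?_, fun h => ⟨_, _, h, h1, h2⟩⟩
    rw [Parade.B_index_unique h1 hi, Parade.B_index_unique h2 hj]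
    exact hij

end Transfer

/-! ### Regularity from concavity and coherence, and the main theorem. -/

section Main

open scoped Classical

variable {U V ι : Type*}

/-- Concavity and coherence yield regularity. -/
theorem isRegularPair_of_concave [Finite V] (G : Bigraph V) {L W₁ W₂ : ℕ} (A : ι → Finset V)
    (B : Fin L → Finset V) (lam : ℝ) (hA : ∀ i, (A i).card = W₁) (hB : ∀ j, (B j).card = W₂)
    (hconcave : ∀ Y : Set V, (Y ⊆ ⋃ i, (A i : Set V)) → ¬ ∃ h₁ h₂ h₃ : Fin L, h₁ < h₂ ∧ h₂ < h₃ ∧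
      G.Covers lam Y (B h₂) ∧ G.Misses lam Y (B h₁) ∧ G.Misses lam Y (B h₃))
    (hdeg : ∀ i, ∀ x ∈ A i, (G.degree x : ℝ) ≤ 1 / 1000 * W₂)
    (hdense : ∀ i j, ∀ Z₁ ⊆ A i, ∀ Z₂ ⊆ B j, W₁ ≤ 4 * Z₁.card → W₂ ≤ 2 * Z₂.card →
      ∃ x ∈ Z₁, ∃ y ∈ Z₂, G.graph.Adj x y) :
    IsRegularPair G.graph A B lam := by
  have hcov : ∀ (Y : Finset V) j, ({y ∈ (B j : Set V) | ∃ x ∈ (Y : Set V), G.graph.Adj x y}.ncard)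
      = (nbrsIn G.graph Y (B j)).card := by
    intro Y j
    rw [← Set.ncard_coe_finset]
    congr 1
    ext y
    simp [mem_nbrsIn]
  have hmis : ∀ (Y : Finset V) j,
      ({y ∈ (B j : Set V) | ¬ ∃ x ∈ (Y : Set V), G.graph.Adj x y}.ncard)
      = (B j \ nbrsIn G.graph Y (B j)).card := by
    intro Y j
    rw [← Set.ncard_coe_finset]
    congr 1
    ext y
    simp only [Set.mem_ofPred_eq, Finset.mem_coe, Finset.mem_sdiff, mem_nbrsIn]
    exact ⟨fun h => ⟨h.1, fun h' => h.2 h'.2⟩, fun h => ⟨h.1, fun h' => h.2 ⟨h.1, h'⟩⟩⟩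
  have hsdiff : ∀ (Y : Finset V) j,
      (B j \ nbrsIn G.graph Y (B j)).card + (nbrsIn G.graph Y (B j)).card = (B j).card :=
    fun Y j => Finset.card_sdiff_add_card_eq_card (Finset.filter_subset _ _)
  refine ⟨?_, ?_, ?_⟩
  · intro i Y hY h₁ h₂ h₃ h12 h23 hc hm₁ hm₃
    have hmiss : ∀ j, ((nbrsIn G.graph Y (B j)).card : ℝ) ≤ (1 - lam) * (B j).card →
        G.Misses lam Y (B j) := by
      intro j hj
      unfold Bigraph.Misses
      rw [hmis, Set.ncard_coe_finset]
      have : ((B j \ nbrsIn G.graph Y (B j)).card : ℝ) + (nbrsIn G.graph Y (B j)).card = (B j).card := by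
        exact_mod_cast hsdiff Y j
      linarith
    refine hconcave Y (fun v hv => Set.mem_iUnion.2 ⟨i, hY hv⟩) ⟨h₁, h₂, h₃, h12, h23, ?_,
      hmiss _ hm₁, hmiss _ hm₃⟩
    unfold Bigraph.Covers
    rw [hcov, Set.ncard_coe_finset]
    exact hc
  · intro i x hx j
    refine le_trans ?_ ((hdeg i x hx).trans (by rw [hB]))
    have : (nbrsIn G.graph {x} (B j)).card ≤ G.degree x := by
      unfold Bigraph.degree
      rw [← Set.ncard_coe_finset]
      refine Set.ncard_le_ncard ?_ (Set.toFinite _)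
      intro y hy
      obtain ⟨-, z, hz, hzy⟩ := mem_nbrsIn.1 hy
      rw [Finset.mem_singleton.1 hz] at hzy
      exact hzy
    exact_mod_cast this
  · intro i Z hZ hZc j
    by_contra! hcon
    rw [hA] at hZc
    have h1 := hsdiff Z j
    have h2 := hB j
    obtain ⟨x, hx, y, hy, hxy⟩ := hdense i j Z hZ (B j \ nbrsIn G.graph Z (B j))
      Finset.sdiff_subset hZc (by omega)
    obtain ⟨hyB, hyN⟩ := Finset.mem_sdiff.1 hy
    exact hyN (mem_nbrsIn.2 ⟨hyB, x, hx, hxy⟩)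

end Main

theorem mainTheorem6
    (δ η : ℕ) (hδ : 2 ≤ δ)
    {U : Type*} [Finite U] (T : Bigraph U) (root : U) (hT : T.graph.IsTree)
    (hdeg : ∀ v, T.degree v ≤ δ + 1)
    (hpath : ∀ (v : U) (p : T.graph.Walk root v), T.degree v = 1 → p.IsPath → p.length < η)
    (τ K : ℕ) (hτ : τ = δ ^ (η + 1)) (hK : K = (32 * δ + 4) * τ + 2)
    (lam : ℝ) (hlam : lam = (2 : ℝ) ^ (-(30 * (δ : ℤ))) * (δ : ℝ) ^ (-1 - (η : ℤ)))
    {V : Type*} [Finite V] (G : Bigraph V) (K₁ K₂ : ℕ) (hK₁ : K ≤ K₁) (hK₂ : K ≤ K₂)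
    (P : Parade G K₁ K₂) (W₁ W₂ : ℕ) (hW : P.HasWidth W₁ W₂)
    (hconcave : P.IsConcave lam)
    (hinvariant : P.IsSupportInvariant ((2 : ℝ) ^ (-(30 * (δ : ℤ)))) τ)
    (huniform : P.IsSupportUniform τ)
    (ε : ℝ)
    (hε : ε ≤ (2 : ℝ) ^ (-(30 * (δ : ℤ)) - 1) *
      min ((W₁ : ℝ) / (G.V₁.ncard : ℝ)) ((W₂ : ℝ) / (G.V₂.ncard : ℝ)))
    (hcoherent : G.IsCoherent ε) :
    P.HasRainbowCopy T := by
  classical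
  have := Fintype.ofFinite U
  set κ : ℝ := (2 : ℝ) ^ (-(30 * (δ : ℤ))) with hκdef
  have hκ : 0 < κ := by positivity
  have hκ' : κ ≤ 1 / 1000 := by
    calc κ ≤ (2 : ℝ) ^ (-10 : ℤ) := zpow_le_zpow_right₀ (by norm_num) (by omega)
      _ ≤ 1 / 1000 := by norm_num
  have hδ0 : (0 : ℝ) < δ := by exact_mod_cast (by omega : 0 < δ)
  have hlam0 : 0 < lam := by rw [hlam]; positivity
  -- The powers of δ in τ and λ cancel, so equality holds.
  have hlamτ : (τ : ℝ) * lam ≤ κ := by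
    have h1 : (τ : ℝ) = (δ : ℝ) ^ ((η : ℤ) + 1) := by
      rw [hτ]
      push_cast
      exact_mod_cast rfl
    have h2 : (δ : ℝ) ^ ((η : ℤ) + 1) * (δ : ℝ) ^ (-1 - (η : ℤ)) = 1 := by
      rw [← zpow_add₀ hδ0.ne', show (η : ℤ) + 1 + (-1 - η) = 0 by ring, zpow_zero]
    rw [hlam, h1, mul_left_comm, h2, mul_one]
  have hτ1 : 1 ≤ τ := hτ ▸ Nat.one_le_pow _ _ (by omega)
  have hKτ : 2 * τ + 6 ≤ K := by
    rw [hK]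
    nlinarith
  have hUτ : Fintype.card U ≤ τ :=
    hτ ▸ card_le_of_height T.graph hT root δ η hδ hdeg hpath
  have hA : ∀ i, (P.finA i).card = W₁ := fun i => by rw [Parade.card_finA, hW.1]
  have hB : ∀ j, (P.finB j).card = W₂ := fun j => by rw [Parade.card_finB, hW.2]
  let i₀ : Fin K₁ := ⟨0, by omega⟩
  let j₀ : Fin K₂ := ⟨0, by omega⟩
  have hW₁ : 0 < W₁ := by
    rw [← hW.1 i₀]
    exact (Set.ncard_pos (Set.toFinite _)).2 (P.A_nonempty _)
  have hW₂ : 0 < W₂ := by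
    rw [← hW.2 j₀]
    exact (Set.ncard_pos (Set.toFinite _)).2 (P.B_nonempty _)
  have hW₁r : (0 : ℝ) < W₁ := by exact_mod_cast hW₁
  have hW₂r : (0 : ℝ) < W₂ := by exact_mod_cast hW₂
  have hV₁ : (0 : ℝ) < G.V₁.ncard := by
    have : (P.A i₀).ncard ≤ G.V₁.ncard := Set.ncard_le_ncard (P.A_subset _) (Set.toFinite _)
    rw [hW.1] at this
    exact_mod_cast hW₁.trans_le this
  have hV₂ : (0 : ℝ) < G.V₂.ncard := by
    have : (P.B j₀).ncard ≤ G.V₂.ncard := Set.ncard_le_ncard (P.B_subset _) (Set.toFinite _)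
    rw [hW.2] at this
    exact_mod_cast hW₂.trans_le this
  have hhalf : (2 : ℝ) ^ (-(30 * (δ : ℤ)) - 1) ≤ 1 / 1000 := by
    rw [zpow_sub_one₀ (by norm_num)]
    linarith
  have hε₁ : ε * G.V₁.ncard ≤ 1 / 1000 * W₁ := by
    have h1 : ε ≤ 1 / 1000 * (W₁ / G.V₁.ncard) :=
      hε.trans (mul_le_mul hhalf (min_le_left _ _) (by positivity) (by norm_num))
    calc ε * G.V₁.ncard ≤ 1 / 1000 * ((W₁ : ℝ) / G.V₁.ncard) * G.V₁.ncard := mul_le_mul_of_nonneg_right h1 hV₁.le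
      _ = _ := by field_simp
  have hε₂ : ε * G.V₂.ncard ≤ 1 / 1000 * W₂ := by
    have h1 : ε ≤ 1 / 1000 * (W₂ / G.V₂.ncard) :=
      hε.trans (mul_le_mul hhalf (min_le_right _ _) (by positivity) (by norm_num))
    calc ε * G.V₂.ncard ≤ 1 / 1000 * ((W₂ : ℝ) / G.V₂.ncard) * G.V₂.ncard := mul_le_mul_of_nonneg_right h1 hV₂.le
      _ = _ := by field_simp
  obtain ⟨-, hc₁, hc₂, hc⟩ := hcoherent
  -- The bound on ε gives ε|Vᵢ| ≤ Wᵢ/1000, so quarters of blocks are large enough for coherence.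
  have hcoh : ∀ i j, ∀ Z₁ ⊆ P.finA i, ∀ Z₂ ⊆ P.finB j, W₁ ≤ 4 * Z₁.card → W₂ ≤ 4 * Z₂.card →
      ∃ x ∈ Z₁, ∃ y ∈ Z₂, G.graph.Adj x y := by
    intro i j Z₁ hZ₁ Z₂ hZ₂ h₁ h₂
    by_contra! hcon
    have h₁' : (W₁ : ℝ) ≤ 4 * Z₁.card := by exact_mod_cast h₁
    have h₂' : (W₂ : ℝ) ≤ 4 * Z₂.card := by exact_mod_cast h₂
    refine hc ⟨Z₁, Z₂, fun v hv => P.A_subset i (Parade.mem_finA.1 (hZ₁ hv)),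
      fun v hv => P.B_subset j (Parade.mem_finB.1 (hZ₂ hv)), hcon, ?_, ?_⟩
    · rw [Set.ncard_coe_finset]; linarith
    · rw [Set.ncard_coe_finset]; linarith
  have hAB : IsRegularPair G.graph P.finA P.finB lam := by
    refine isRegularPair_of_concave G P.finA P.finB lam hA hB ?_ ?_ ?_
    · intro Y hY
      have := hconcave.2 Y (by simpa [Parade.finA] using hY)
      simpa [Parade.finB] using this
    · intro i x hx
      exact (hc₁ x (P.A_subset i (Parade.mem_finA.1 hx))).le.trans hε₂
    · intro i j Z₁ hZ₁ Z₂ hZ₂ h₁ h₂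
      exact hcoh i j Z₁ hZ₁ Z₂ hZ₂ h₁ (by omega)
  have hBA : IsRegularPair G.graph P.finB P.finA lam := by
    refine isRegularPair_of_concave G P.finB P.finA lam hB hA ?_ ?_ ?_
    · intro Y hY
      have := hconcave.1 Y (by simpa [Parade.finB] using hY)
      simpa [Parade.finA] using this
    · intro i x hx
      exact (hc₂ x (P.B_subset i (Parade.mem_finB.1 hx))).le.trans hε₁
    · intro j i Z₂ hZ₂ Z₁ hZ₁ h₂ h₁
      obtain ⟨x, hx, y, hy, hxy⟩ := hcoh i j Z₁ hZ₁ Z₂ hZ₂ (by omega) h₂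
      exact ⟨y, hy, x, hx, hxy.symm⟩
  obtain ⟨φ, p, q, hcopy⟩ := exists_copy_of_isRegularPair hA hB hW₁ hW₂ hκ hκ' hlam0 hlamτ hτ1
    (hKτ.trans hK₁) (hKτ.trans hK₂) hAB hBA T.graph hT T.V₁ T.V₂ T.isCompl.disjoint
    (fun u v h => T.isBipartiteWith.2 h) hUτ
    (hasTransfer_of_parade P (by omega) (by omega) T hT.isAcyclic κ τ hκ hinvariant huniform)
  obtain ⟨iso, -⟩ := hcopy.exists_iso T id Function.injective_id (fun u => by simp)
    (fun _ _ => Iff.rfl) (fun _ => Iff.rfl)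
  exact ⟨_, hcopy.isRainbow, ⟨iso⟩⟩
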